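/- **Theorem (localization principle).** Let $n\ge 0$ be an integer and write $\langle\xi\rangle=(1+|\xi|^2)^{1/2}$ for $\xi\in\mathbb{R}^n$. Let $k:\mathbb{R}^n\to(0,\infty)$ be a weight function of polynomial growth, i.e. $k$ is measurable and there are constants $C,N>0$ with $$k(\xi+\eta)\le C\langle\xi\rangle^{N}k(\eta)\qquad(\xi,\eta\in\mathbb{R}^n).$$ Let $\mathcal{B}_k(\mathbb{R}^n)$ be the space of all $u\in\mathcal{S}'(\mathbb{R}^n)$ such that the Fourier transform $\widehat u$ (given by $\widehat\varphi(\xi)=\int e^{-i\langle x,\xi\rangle}\varphi(x)\,dx$ on Schwartz functions) is a function and $k\widehat u\in L^2(\mathbb{R}^n)$, with the norm $\|u\|_{\mathcal{B}_k}=\|k\widehat u\|_{L^2}$. For $\chi\in C_0^\infty(\mathbb{R}^n)$ and $y\in\mathbb{R}^n$ put $\tau_y\chi=\chi(\cdot-y)$. Let $\mathcal{B}_k^2(\mathbb{R}^n)$ be the space of all distributions $u\in\mathcal{D}'(\mathbb{R}^n)$ for which there is some $\chi\in C_0^\infty(\mathbb{R}^n)\setminus\{0\}$ such that $u\,\tau_y\chi\in\mathcal{B}_k(\mathbb{R}^n)$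 for all $y$ and the function $y\mapsto\|u\,\tau_y\chi\|_{\mathcal{B}_k}$ belongs to $L^2(\mathbb{R}^n)$; for $\chi\in C_0^\infty(\mathbb{R}^n)\setminus\{0\}$ put $$\|u\|_{k,2,\chi}=\Big(\int_{\mathbb{R}^n}\|u\,\tau_y\chi\|_{\mathcal{B}_k}^2\,dy\Big)^{1/2}.$$ Let $W(\mathcal{B}_k,L^2)$ be the Wiener amalgam space with local component $\mathcal{B}_k$, global component $L^2$ and window $\chi\in C_0^\infty(\mathbb{R}^n)\setminus\{0\}$, i.e. the space of all $u\in\mathcal{D}'(\mathbb{R}^n)$ such that $\varphi u\in\mathcal{B}_k(\mathbb{R}^n)$ for all $\varphi\in C_0^\infty(\mathbb{R}^n)$ and $y\mapsto\|u\,\tau_y\chi\|_{\mathcal{B}_k}$ belongs to $L^2(\mathbb{R}^n)$. Then, as subspaces of $\mathcal{D}'(\mathbb{R}^n)$, $$\mathcal{B}_k(\mathbb{R}^n)=\mathcal{B}_k^2(\mathbb{R}^n)=W(\mathcal{B}_k,L^2),$$ the last space being formed with any window $\chi\ne0$, and the norms are equivalent: for every $\chi\in C_0^\infty(\mathbb{R}^n)\setminus\{0\}$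 there is a constant $C>0$ such that $$\|u\|_{k,2,\chi}\le C\|u\|_{\mathcal{B}_k}\quad\text{and}\quad\|u\|_{\mathcal{B}_k}\le C\|u\|_{k,2,\chi}\qquad\text{for all }u\in\mathcal{B}_k(\mathbb{R}^n).$$ -/

import Mathlib

open MeasureTheory TopologicalSpace SchwartzMap
open scoped Distributions ENNReal NNReal ContDiff FourierTransform

noncomputable section

namespace Kato

/-- `ℝⁿ` with the Euclidean norm. -/
abbrev Rn (n : ℕ) : Type := EuclideanSpace ℝ (Fin n)

/-- `C₀^∞(ℝⁿ)`: complex-valued smooth functions with compact support. -/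
abbrev Test (n : ℕ) : Type := 𝓓((⊤ : Opens (Rn n)), ℂ)

/-- `𝓓'(ℝⁿ)`: continuous `ℂ`-linear functionals on `C₀^∞(ℝⁿ)` with its LF topology. -/
abbrev Distr (n : ℕ) : Type := Test n →L[ℂ] ℂ

/-- `𝓚_pol(ℝⁿ)`: weight functions of polynomial growth. -/
structure IsWeight {n : ℕ} (k : Rn n → ℝ) : Prop where
  measurable : Measurable k
  pos : ∀ ξ, 0 < k ξ
  growth : ∃ C N : ℝ, 0 < C ∧ 0 < N ∧
    ∀ ξ η : Rn n, k (ξ + η) ≤ C * (Real.sqrt (1 + ‖ξ‖ ^ 2)) ^ N * k η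

variable {n : ℕ}

/-! ### Inclusion of test functions in Schwartz functions, restriction of tempered distributions -/

/-- A test function, seen as a Schwartz function. -/
def Test.toSchwartz (φ : Test n) : 𝓢(Rn n, ℂ) :=
  φ.hasCompactSupport.toSchwartzMap φ.contDiff

@[simp] theorem Test.toSchwartz_apply (φ : Test n) (x : Rn n) : φ.toSchwartz x = φ x := rfl

/-- The inclusion `C₀^∞(ℝⁿ) ⊂ 𝓢(ℝⁿ)` as a continuous linear map. -/
def testToSchwartz (n : ℕ) : Test n →L[ℂ] 𝓢(Rn n, ℂ) :=
  TestFunction.mkCLM ℂ Test.toSchwartz (fun _ _ => by ext; rfl) (fun _ _ => by ext; rfl) <| by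
    intro K hK
    let L : 𝓓^{⊤}_{K}(Rn n, ℂ) →ₗ[ℂ] 𝓢(Rn n, ℂ) :=
      { toFun := Test.toSchwartz ∘ TestFunction.ofSupportedIn hK
        map_add' := fun _ _ => by ext; rfl
        map_smul' := fun _ _ => by ext; rfl }
    change Continuous L
    refine WithSeminorms.continuous_of_continuous_comp (schwartz_withSeminorms ℂ (Rn n) ℂ) L ?_
    rintro ⟨l, i⟩
    obtain ⟨R, hR⟩ := K.isCompact.isBounded.exists_norm_le
    let q := ContDiffMapSupportedIn.seminorm ℂ (Rn n) ℂ ⊤ K i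
    have hq : Continuous q :=
      (ContDiffMapSupportedIn.withSeminorms ℂ (Rn n) ℂ ⊤ K).continuous_seminorm i
    let c : ℝ≥0 := (max R 0).toNNReal ^ l
    have hcq : Continuous (c • q : Seminorm ℂ 𝓓^{⊤}_{K}(Rn n, ℂ)) := by
      change Continuous fun f => (c : ℝ) * q f
      fun_prop
    refine Seminorm.continuous_of_le hcq ?_
    intro f
    change SchwartzMap.seminorm ℂ l i (L f) ≤ (c : ℝ) * q f
    refine SchwartzMap.seminorm_le_bound ℂ l i _ (by positivity) ?_
    intro x
    change ‖x‖ ^ l * ‖iteratedFDeriv ℝ i f x‖ ≤ _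
    by_cases hx : x ∈ K
    · have h1 : ‖x‖ ≤ max R 0 := (hR x hx).trans (le_max_left _ _)
      have h2 : ‖iteratedFDeriv ℝ i f x‖ ≤ q f :=
        ContDiffMapSupportedIn.norm_iteratedFDeriv_apply_le_seminorm_top ℂ
      have hc : (c : ℝ) = (max R 0) ^ l := by simp [c]
      rw [hc]
      gcongr
    · rw [f.iteratedFDeriv_zero_on_compl hx]
      simp only [Pi.zero_apply, norm_zero, mul_zero]
      positivity

/-- The canonical map `𝓢'(ℝⁿ) → 𝓓'(ℝⁿ)`, restriction to test functions. -/
def restrict (T : 𝓢'(Rn n, ℂ)) : Distr n :=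
  (show 𝓢(Rn n, ℂ) →L[ℂ] ℂ from T) ∘L testToSchwartz n

theorem restrict_apply (T : 𝓢'(Rn n, ℂ)) (φ : Test n) : restrict T φ = T φ.toSchwartz := rfl

/-! ### Product of a distribution with a test function, as a tempered distribution -/

/-- Multiplication by the test function `χ`, as a map from `𝓢(ℝⁿ)` to smooth functions supported
in `supp χ`. -/
def mulSupportedIn (χ : Test n) :
    𝓢(Rn n, ℂ) →L[ℂ] 𝓓^{⊤}_{(⟨tsupport χ, χ.hasCompactSupport⟩ : Compacts (Rn n))}(Rn n, ℂ) where
  toFun φ := .of_support_subset (f := fun x => χ x * φ x) (χ.contDiff.mul (φ.smooth ⊤))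
    fun x hx => subset_closure (left_ne_zero_of_mul hx)
  map_add' φ ψ := by ext x; exact mul_add _ _ _
  map_smul' c φ := by ext x; exact mul_left_comm _ _ _
  cont := by
    let K : Compacts (Rn n) := ⟨tsupport χ, χ.hasCompactSupport⟩
    let L : 𝓢(Rn n, ℂ) →ₗ[ℂ] 𝓓^{⊤}_{K}(Rn n, ℂ) :=
      { toFun := fun φ => .of_support_subset (f := fun x => χ x * φ x)
          (χ.contDiff.mul (φ.smooth ⊤)) fun x hx => subset_closure (left_ne_zero_of_mul hx)
        map_add' := fun φ ψ => by ext x; exact mul_add _ _ _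
        map_smul' := fun c φ => by ext x; exact mul_left_comm _ _ _ }
    change Continuous L
    refine WithSeminorms.continuous_of_continuous_comp
      (ContDiffMapSupportedIn.withSeminorms ℂ (Rn n) ℂ ⊤ K) L ?_
    intro i
    let M : 𝓢(Rn n, ℂ) →L[ℂ] 𝓢(Rn n, ℂ) := SchwartzMap.smulLeftCLM ℂ χ.toSchwartz
    have hM : Continuous ((SchwartzMap.seminorm ℂ 0 i).comp
        (M : 𝓢(Rn n, ℂ) →ₗ[ℂ] 𝓢(Rn n, ℂ))) :=
      ((schwartz_withSeminorms ℂ (Rn n) ℂ).continuous_seminorm (0, i)).comp M.continuous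
    refine Seminorm.continuous_of_le hM ?_
    intro φ
    change ContDiffMapSupportedIn.seminorm ℂ (Rn n) ℂ ⊤ K i (L φ) ≤
      SchwartzMap.seminorm ℂ 0 i (M φ)
    rw [ContDiffMapSupportedIn.seminorm_top_le_iff ℂ (apply_nonneg _ _)]
    intro x _
    have hfun : (L φ : Rn n → ℂ) = M φ := by
      ext y
      simp only [M]
      rw [SchwartzMap.smulLeftCLM_apply_apply χ.toSchwartz.hasTemperateGrowth]
      rfl
    rw [hfun]
    exact SchwartzMap.norm_iteratedFDeriv_le_seminorm ℂ (M φ) i x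

/-- Multiplication by the test function `χ`, as a continuous linear map `𝓢(ℝⁿ) → C₀^∞(ℝⁿ)`. -/
def mulTest (χ : Test n) : 𝓢(Rn n, ℂ) →L[ℂ] Test n :=
  (TestFunction.ofSupportedInCLM ℂ (Set.subset_univ _)) ∘L mulSupportedIn χ

theorem mulTest_apply (χ : Test n) (φ : 𝓢(Rn n, ℂ)) (x : Rn n) :
    mulTest χ φ x = χ x * φ x := rfl

/-- The product `χ u` of `u ∈ 𝓓'(ℝⁿ)` and `χ ∈ C₀^∞(ℝⁿ)`. It has compact support, hence it is a
tempered distribution: `⟨χ u, φ⟩ = ⟨u, χ φ⟩` for all Schwartz functions `φ`. -/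
def smulDistr (χ : Test n) (u : Distr n) : 𝓢'(Rn n, ℂ) :=
  ContinuousLinearMap.toPointwiseConvergenceCLM _ _ _ _ (u ∘L mulTest χ)

theorem smulDistr_apply (χ : Test n) (u : Distr n) (φ : 𝓢(Rn n, ℂ)) :
    smulDistr χ u φ = u (mulTest χ φ) := rfl

/-- The translate `τ_y χ = χ(· - y)`. -/
def translate (y : Rn n) (χ : Test n) : Test n where
  toFun x := χ (x - y)
  contDiff' := χ.contDiff.comp (contDiff_id.sub contDiff_const)
  hasCompactSupport' := by
    simpa [Function.comp_def] using
      χ.hasCompactSupport.comp_homeomorph (Homeomorph.subRight y)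
  tsupport_subset' := Set.subset_univ _

theorem translate_apply (y : Rn n) (χ : Test n) (x : Rn n) : translate y χ x = χ (x - y) := rfl

/-! ### Fourier transform with the kernel `e^{-i⟨x, ξ⟩}` -/

/-- The dilation `ξ ↦ (2π)⁻¹ ξ` of `ℝⁿ`. -/
def dilation (n : ℕ) : Rn n ≃L[ℝ] Rn n :=
  ContinuousLinearEquiv.smulLeft (Units.mk0 ((2 * Real.pi)⁻¹ : ℝ) (by positivity))

/-- The Fourier transform `φ̂(ξ) = ∫ e^{-i⟨x, ξ⟩} φ(x) dx` on Schwartz functions (Mathlib's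
transform has the kernel `e^{-2πi⟨x, ξ⟩}`). -/
def hat (n : ℕ) : 𝓢(Rn n, ℂ) →L[ℂ] 𝓢(Rn n, ℂ) :=
  (SchwartzMap.compCLMOfContinuousLinearEquiv ℂ (dilation n)) ∘L
    (FourierTransform.fourierCLM ℂ 𝓢(Rn n, ℂ))

theorem hat_apply (φ : 𝓢(Rn n, ℂ)) (ξ : Rn n) :
    hat n φ ξ = ∫ x, Complex.exp (-Complex.I * (inner ℝ x ξ : ℝ)) * φ x := by
  change (𝓕 φ) ((2 * Real.pi)⁻¹ • ξ) = _
  rw [SchwartzMap.fourier_coe, Real.fourier_eq']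
  refine integral_congr_ae (.of_forall fun x => ?_)
  simp only [inner_smul_right, smul_eq_mul]
  congr 2
  have : (Real.pi : ℂ) ≠ 0 := by exact_mod_cast Real.pi_ne_zero
  push_cast
  field_simp

/-- The Fourier transform of a tempered distribution: `⟨T̂, φ⟩ = ⟨T, φ̂⟩`. -/
def hatDistr (T : 𝓢'(Rn n, ℂ)) : 𝓢'(Rn n, ℂ) :=
  PointwiseConvergenceCLM.precomp ℂ (hat n) T

theorem hatDistr_apply (T : 𝓢'(Rn n, ℂ)) (φ : 𝓢(Rn n, ℂ)) : hatDistr T φ = T (hat n φ) := rfl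

/-! ### The space `𝓑_k = B_{2,k}` -/

/-- The tempered distribution `T` is (given by) the function `f`: `⟨T, φ⟩ = ∫ φ f` with absolutely
convergent integrals. (If `k f ∈ L²` for a weight `k` of polynomial growth, the integrals converge
absolutely for every Schwartz function `φ`.) -/
def IsFunction (T : 𝓢'(Rn n, ℂ)) (f : Rn n → ℂ) : Prop :=
  LocallyIntegrable f ∧
    ∀ φ : 𝓢(Rn n, ℂ), Integrable (fun ξ => φ ξ * f ξ) ∧ T φ = ∫ ξ, φ ξ * f ξ

/-- `𝓑_k(ℝⁿ)`: tempered distributions `T` such that `T̂` is a function and `k T̂ ∈ L²`. -/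
def hormanderSpace (k : Rn n → ℝ) : Set 𝓢'(Rn n, ℂ) :=
  {T | ∃ f : Rn n → ℂ, IsFunction (hatDistr T) f ∧ MemLp (fun ξ => (k ξ : ℂ) * f ξ) 2 volume}

/-- The norm `‖T‖_{𝓑_k} = ‖k T̂‖_{L²}`, with the value `∞` outside `𝓑_k`. (The function `T̂` is
unique up to null sets, so the infimum runs over at most one value.) -/
def hormanderNorm (k : Rn n → ℝ) (T : 𝓢'(Rn n, ℂ)) : ℝ≥0∞ :=
  ⨅ (f : Rn n → ℂ) (_ : IsFunction (hatDistr T) f), eLpNorm (fun ξ => (k ξ : ℂ) * f ξ) 2 volume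

/-! ### The Kato-Sobolev type spaces `𝓑_k^p` and Wiener amalgam spaces -/

/-- The function `y ↦ ‖u τ_y χ‖_{𝓑_k}`. -/
def control (k : Rn n → ℝ) (χ : Test n) (u : Distr n) (y : Rn n) : ℝ≥0∞ :=
  hormanderNorm k (smulDistr (translate y χ) u)

/-- The norm `‖u‖_{k,p,χ}`, the `L^p` norm of `y ↦ ‖u τ_y χ‖_{𝓑_k}`. -/
def katoNorm (k : Rn n → ℝ) (p : ℝ≥0∞) (χ : Test n) (u : Distr n) : ℝ≥0∞ :=
  eLpNorm (control k χ u) p volume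

/-- `𝓑_k^p(ℝⁿ)`: distributions `u` such that for some test function `χ ≠ 0` all `u τ_y χ` are in
`𝓑_k` and `y ↦ ‖u τ_y χ‖_{𝓑_k}` is in `L^p`. -/
def katoSpace (k : Rn n → ℝ) (p : ℝ≥0∞) : Set (Distr n) :=
  {u | ∃ χ : Test n, χ ≠ 0 ∧ (∀ y, smulDistr (translate y χ) u ∈ hormanderSpace k) ∧
    MemLp (control k χ u) p volume}

/-- `𝓑_k^loc(ℝⁿ)`: distributions that are locally in `𝓑_k`. -/
def hormanderLoc (k : Rn n → ℝ) : Set (Distr n) :=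
  {u | ∀ φ : Test n, smulDistr φ u ∈ hormanderSpace k}

/-- The Wiener amalgam space `W(𝓑_k, L^p)` with local component `𝓑_k` and global component `L^p`,
formed with the window `χ`: all `u ∈ 𝓑_k^loc` whose control function `y ↦ ‖u τ_y χ‖_{𝓑_k}` is in
`L^p`. -/
def wienerAmalgam (k : Rn n → ℝ) (p : ℝ≥0∞) (χ : Test n) : Set (Distr n) :=
  {u | u ∈ hormanderLoc k ∧ MemLp (control k χ u) p volume}

end Kato

end

noncomputable section

namespace Kato

/-!
Let `f` be the function `T̂` for `T ∈ 𝓑_k`. Then `(χ T)^ = (2π)⁻ⁿ χ̂ ∗ f`, and since translating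
`χ` only modulates `χ̂`, Plancherel's theorem in the translation parameter gives

`‖T‖²_{k,2,χ} = (2π)⁻ⁿ ∫ (∫ k(ξ)² |χ̂(ξ - η)|² dξ) |f(η)|² dη`.

As `k(ξ) ≤ w(ξ - η) k(η)` with `w` of polynomial growth, the inner integral is comparable to
`k(η)²`, which is the equivalence of norms.

Conversely, let `u` have a square integrable control function. Every test function `φ` is a finite
sum of products `ψ_y τ_y χ`, so `φ u ∈ 𝓑_k`. The cutoffs `θ(x / R)` with `R ≥ 1` have uniformly
bounded multiplier norms on `𝓑_k`, so their products with `u` are bounded in `𝓑_k`, and choosing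
`θ(x / R) = 1` on the support of `φ` gives `|u(φ)| ≤ M ‖(𝓕⁻¹ φ) / k‖_{L²}` with `M` independent of
`φ`. By the Riesz representation theorem `û` is then a function `f` with `k f ∈ L²`.
-/

/-! ### Integral inequalities -/

section Lintegral

variable {α : Type*} [MeasurableSpace α] {μ : Measure α}

theorem lintegral_enorm_sq_eq_eLpNorm_sq {ε : Type*} [TopologicalSpace ε] [ContinuousENorm ε]
    (f : α → ε) : ∫⁻ x, ‖f x‖ₑ ^ 2 ∂μ = eLpNorm f 2 μ ^ 2 := by
  have h := eLpNorm_nnreal_pow_eq_lintegral (μ := μ) (f := f) (p := 2) two_ne_zero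
  simpa only [ENNReal.coe_ofNat, NNReal.coe_ofNat, ENNReal.rpow_two] using h.symm

theorem sq_lintegral_mul_le {f g : α → ℝ≥0∞} (hf : AEMeasurable f μ) (hg : AEMeasurable g μ) :
    (∫⁻ x, f x * g x ∂μ) ^ 2 ≤ (∫⁻ x, f x ^ 2 ∂μ) * ∫⁻ x, g x ^ 2 ∂μ := by
  have sqrt_sq (t : ℝ≥0∞) : (t ^ (1 / 2 : ℝ)) ^ 2 = t := by
    rw [← ENNReal.rpow_natCast, ← ENNReal.rpow_mul]
    norm_num
  have holder := pow_le_pow_left' (ENNReal.lintegral_mul_le_Lp_mul_Lq μ .two_two hf hg) 2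
  simpa only [Pi.mul_apply, mul_pow, sqrt_sq, ENNReal.rpow_two] using holder

theorem sq_lintegral_mul_le_lintegral_mul {a b : α → ℝ≥0∞} (ha : AEMeasurable a μ)
    (hb : AEMeasurable b μ) :
    (∫⁻ x, a x * b x ∂μ) ^ 2 ≤ (∫⁻ x, a x ∂μ) * ∫⁻ x, a x * b x ^ 2 ∂μ := by
  have sqrt_mul_sqrt (t : ℝ≥0∞) : t ^ (1 / 2 : ℝ) * t ^ (1 / 2 : ℝ) = t := by
    rw [← ENNReal.rpow_add_of_nonneg _ _ (by norm_num) (by norm_num)]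
    norm_num
  have h := sq_lintegral_mul_le (μ := μ) (f := fun x => a x ^ (1 / 2 : ℝ))
    (g := fun x => a x ^ (1 / 2 : ℝ) * b x) (by fun_prop) (by fun_prop)
  simpa only [← mul_assoc, mul_pow, sq (_ ^ (1 / 2 : ℝ)), sqrt_mul_sqrt] using h

theorem lintegral_comp_smul {E : Type*} [NormedAddCommGroup E] [NormedSpace ℝ E]
    [MeasurableSpace E] [BorelSpace E] [FiniteDimensional ℝ E] (ν : Measure E)
    [ν.IsAddHaarMeasure] (f : E → ℝ≥0∞) {r : ℝ} (hr : r ≠ 0) :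
    ∫⁻ x, f (r • x) ∂ν =
      ENNReal.ofReal |(r ^ Module.finrank ℝ E)⁻¹| * ∫⁻ x, f x ∂ν := by
  rw [← smul_eq_mul, ← lintegral_smul_measure, ← Measure.map_addHaar_smul ν hr]
  exact ((Homeomorph.smulOfNeZero r hr).measurableEmbedding.lintegral_map f).symm

end Lintegral

section Convolution

variable {G : Type*} [AddGroup G] [MeasurableSpace G] [MeasurableAdd₂ G] [MeasurableNeg G]
  {μ : Measure G} [SFinite μ] [μ.IsAddRightInvariant]

theorem lintegral_lintegral_sub_mul {a b : G → ℝ≥0∞} (ha : Measurable a) (hb : Measurable b) :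
    ∫⁻ ξ, ∫⁻ η, a (ξ - η) * b η ∂μ ∂μ = (∫⁻ ζ, a ζ ∂μ) * ∫⁻ η, b η ∂μ := by
  calc ∫⁻ ξ, ∫⁻ η, a (ξ - η) * b η ∂μ ∂μ
      = ∫⁻ η, (∫⁻ ξ, a (ξ - η) ∂μ) * b η ∂μ := by
        rw [lintegral_lintegral_swap (by fun_prop)]
        exact lintegral_congr fun η => lintegral_mul_const _ (by fun_prop)
    _ = (∫⁻ ζ, a ζ ∂μ) * ∫⁻ η, b η ∂μ := by
        simp only [lintegral_sub_right_eq_self, lintegral_const_mul _ hb]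

theorem lintegral_sq_convolution_le [μ.IsAddLeftInvariant] [μ.IsNegInvariant] {a b : G → ℝ≥0∞}
    (ha : Measurable a) (hb : Measurable b) :
    ∫⁻ ξ, (∫⁻ η, a (ξ - η) * b η ∂μ) ^ 2 ∂μ ≤ (∫⁻ ζ, a ζ ∂μ) ^ 2 * ∫⁻ η, b η ^ 2 ∂μ := by
  calc ∫⁻ ξ, (∫⁻ η, a (ξ - η) * b η ∂μ) ^ 2 ∂μ
      ≤ ∫⁻ ξ, (∫⁻ ζ, a ζ ∂μ) * ∫⁻ η, a (ξ - η) * b η ^ 2 ∂μ ∂μ := by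
        refine lintegral_mono fun ξ => ?_
        rw [← lintegral_sub_left_eq_self a ξ]
        exact sq_lintegral_mul_le_lintegral_mul (by fun_prop) (by fun_prop)
    _ = (∫⁻ ζ, a ζ ∂μ) ^ 2 * ∫⁻ η, b η ^ 2 ∂μ := by
        rw [lintegral_const_mul _ (Measurable.lintegral_prod_right (by fun_prop)),
          lintegral_lintegral_sub_mul ha (hb.pow_const 2), ← mul_assoc, sq]

end Convolution

/-! ### Moderate weights -/

section Moderate

variable {G : Type*} [AddGroup G]

/-- The weight `k` is `w`-moderate. Weights take values in `[0, ∞]`, so that all the integrals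
below make sense without integrability assumptions. -/
def IsModerate (w k : G → ℝ≥0∞) : Prop :=
  ∀ ξ η, k (ξ + η) ≤ w ξ * k η

theorem IsModerate.le_sub_mul {w k : G → ℝ≥0∞} (h : IsModerate w k) (ξ η : G) :
    k ξ ≤ w (ξ - η) * k η := by
  simpa only [sub_add_cancel] using h (ξ - η) η

variable [MeasurableSpace G] [MeasurableAdd₂ G] [MeasurableNeg G] {μ : Measure G}
  [μ.IsAddRightInvariant] {w k a b : G → ℝ≥0∞}

theorem IsModerate.lintegral_sq_convolution_le [SFinite μ] [μ.IsAddLeftInvariant]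
    [μ.IsNegInvariant] (h : IsModerate w k) (hw : Measurable w) (hk : Measurable k)
    (ha : Measurable a) (hb : Measurable b) :
    ∫⁻ ξ, (k ξ * ∫⁻ η, a (ξ - η) * b η ∂μ) ^ 2 ∂μ ≤
      (∫⁻ ζ, w ζ * a ζ ∂μ) ^ 2 * ∫⁻ η, (k η * b η) ^ 2 ∂μ := by
  refine le_trans (lintegral_mono fun ξ => pow_le_pow_left' ?_ 2)
    (Kato.lintegral_sq_convolution_le (hw.mul ha) (hk.mul hb))
  rw [← lintegral_const_mul _ (by fun_prop)]
  refine lintegral_mono fun η => ?_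
  calc k ξ * (a (ξ - η) * b η)
      ≤ w (ξ - η) * k η * (a (ξ - η) * b η) := by gcongr; exact h.le_sub_mul ξ η
    _ = w (ξ - η) * a (ξ - η) * (k η * b η) := by ring

theorem IsModerate.lintegral_sq_mul_sub_le (h : IsModerate w k) (hw : Measurable w)
    (ha : Measurable a) (η : G) :
    ∫⁻ ξ, (k ξ * a (ξ - η)) ^ 2 ∂μ ≤ (∫⁻ ζ, (w ζ * a ζ) ^ 2 ∂μ) * k η ^ 2 := by
  rw [← lintegral_sub_right_eq_self (fun ζ => (w ζ * a ζ) ^ 2) η,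
    ← lintegral_mul_const _ (by fun_prop)]
  refine lintegral_mono fun ξ => ?_
  calc (k ξ * a (ξ - η)) ^ 2 ≤ (w (ξ - η) * k η * a (ξ - η)) ^ 2 := by
        gcongr; exact h.le_sub_mul ξ η
    _ = (w (ξ - η) * a (ξ - η)) ^ 2 * k η ^ 2 := by ring

theorem IsModerate.mul_sq_le_lintegral_sq_mul_sub (h : IsModerate w k) (hw : Measurable w)
    (ha : Measurable a) (η : G) :
    (∫⁻ ζ, (a ζ / w (-ζ)) ^ 2 ∂μ) * k η ^ 2 ≤ ∫⁻ ξ, (k ξ * a (ξ - η)) ^ 2 ∂μ := by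
  rw [← lintegral_sub_right_eq_self (fun ζ => (a ζ / w (-ζ)) ^ 2) η,
    ← lintegral_mul_const _ (by fun_prop)]
  refine lintegral_mono fun ξ => ?_
  rw [← mul_pow, ENNReal.mul_comm_div, mul_comm]
  gcongr
  refine ENNReal.div_le_of_le_mul' ?_
  simpa only [neg_sub] using h.le_sub_mul η ξ

end Moderate

/-! ### Fourier transform -/

theorem eLpNorm_fourier_eq {V F : Type*} [NormedAddCommGroup V] [InnerProductSpace ℝ V]
    [FiniteDimensional ℝ V] [MeasurableSpace V] [BorelSpace V] [NormedAddCommGroup F]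
    [InnerProductSpace ℂ F] [CompleteSpace F] {G : V → F} (h1 : Integrable G) (h2 : MemLp G 2) :
    eLpNorm (𝓕 G) 2 volume = eLpNorm G 2 volume := by
  let g : Lp F 2 (volume : Measure V) := h2.toLp G
  let g_hat : Lp F 2 (volume : Measure V) := 𝓕 g
  have continuous_fourier : Continuous (𝓕 G) :=
    VectorFourier.fourierIntegral_continuous Real.continuous_fourierChar
      (by exact continuous_inner) h1
  have fourier_ae_eq : 𝓕 G =ᵐ[volume] g_hat := by
    refine ae_eq_of_integral_contDiff_smul_eq continuous_fourier.locallyIntegrable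
      ((Lp.memLp _).locallyIntegrable one_le_two) fun φ φ_smooth φ_compact => ?_
    let Φ : 𝓢(V, ℂ) := HasCompactSupport.toSchwartzMap (f := Complex.ofRealCLM ∘ φ)
      (φ_compact.comp_left rfl) (by fun_prop)
    have left : ∫ x, φ x • 𝓕 G x = ∫ x, 𝓕 Φ x • G x := by
      have := VectorFourier.integral_fourierIntegral_smul_eq_flip (L := innerₗ V)
        (μ := volume) (ν := volume) Real.continuous_fourierChar
        (by exact continuous_inner) Φ.integrable h1
      rw [flip_innerₗ] at this
      exact this.symm
    have right : ∫ x, φ x • g_hat x = ∫ x, 𝓕 Φ x • g x := by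
      have := congrArg (fun T : 𝓢'(V, F) => T Φ) (Lp.fourier_toTemperedDistribution_eq g)
      simp only [TemperedDistribution.fourier_apply, Lp.toTemperedDistribution_apply] at this
      exact this.symm
    rw [left, right]
    exact integral_congr_ae (h2.coeFn_toLp.mono fun x hx => congrArg (𝓕 Φ x • ·) hx.symm)
  have norm_eq : eLpNorm g_hat 2 volume = eLpNorm g 2 volume := by
    have := Lp.norm_fourier_eq g
    rwa [Lp.norm_def, Lp.norm_def,
      ENNReal.toReal_eq_toReal_iff' (Lp.eLpNorm_ne_top _) (Lp.eLpNorm_ne_top _)] at this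
  rw [eLpNorm_congr_ae fourier_ae_eq, norm_eq, eLpNorm_congr_ae h2.coeFn_toLp]

theorem lintegral_enorm_sq_integral_exp_inner {V F : Type*} [NormedAddCommGroup V]
    [InnerProductSpace ℝ V] [FiniteDimensional ℝ V] [MeasurableSpace V] [BorelSpace V]
    [NormedAddCommGroup F] [InnerProductSpace ℂ F] [CompleteSpace F] {G : V → F}
    (h1 : Integrable G) (h2 : MemLp G 2) :
    ∫⁻ y, ‖∫ η, Complex.exp (Complex.I * (inner ℝ y η : ℝ)) • G η‖ₑ ^ 2 =
      ENNReal.ofReal ((2 * Real.pi) ^ Module.finrank ℝ V) * ∫⁻ η, ‖G η‖ₑ ^ 2 := by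
  have hr : -(2 * Real.pi)⁻¹ ≠ 0 := by simp [Real.pi_ne_zero]
  have hconst : |((-(2 * Real.pi)⁻¹) ^ Module.finrank ℝ V)⁻¹| =
      (2 * Real.pi) ^ Module.finrank ℝ V := by
    rw [abs_inv, abs_pow, abs_neg, abs_of_pos (by positivity), inv_pow, inv_inv]
  rw [lintegral_enorm_sq_eq_eLpNorm_sq G, ← eLpNorm_fourier_eq h1 h2,
    ← lintegral_enorm_sq_eq_eLpNorm_sq, ← hconst,
    ← lintegral_comp_smul volume (fun y => ‖𝓕 G y‖ₑ ^ 2) hr]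
  refine lintegral_congr fun y => ?_
  congr 2
  rw [Real.fourier_eq']
  refine integral_congr_ae (.of_forall fun η => ?_)
  simp only [inner_smul_right, real_inner_comm]
  congr 2
  push_cast
  field_simp

variable {n : ℕ}

/-- The inverse of the Fourier transform `hat` on Schwartz functions. -/
def hatInv (n : ℕ) : 𝓢(Rn n, ℂ) →L[ℂ] 𝓢(Rn n, ℂ) :=
  (FourierTransform.fourierInvCLM ℂ 𝓢(Rn n, ℂ)) ∘L
    (SchwartzMap.compCLMOfContinuousLinearEquiv ℂ (dilation n).symm)

theorem hatInv_hat (φ : 𝓢(Rn n, ℂ)) : hatInv n (hat n φ) = φ := by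
  have undilate :
      SchwartzMap.compCLMOfContinuousLinearEquiv ℂ (dilation n).symm (hat n φ) = 𝓕 φ := by
    ext x
    simp [hat]
  exact (congrArg 𝓕⁻ undilate).trans (FourierTransform.fourierInv_fourier_eq φ)

theorem hat_hatInv (φ : 𝓢(Rn n, ℂ)) : hat n (hatInv n φ) = φ := by
  ext x
  change (𝓕 (𝓕⁻ (SchwartzMap.compCLMOfContinuousLinearEquiv ℂ (dilation n).symm φ)))
    (dilation n x) = φ x
  simp [FourierTransform.fourier_fourierInv_eq]

theorem hatDistr_surjective : Function.Surjective (hatDistr (n := n)) := fun S =>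
  ⟨PointwiseConvergenceCLM.precomp ℂ (hatInv n) S, by
    ext φ
    exact congrArg S (hatInv_hat φ)⟩

/-- The constant `(2π)⁻ⁿ` in the Fourier inversion formula. -/
def inversionConst (n : ℕ) : ℝ := ((2 * Real.pi) ^ n)⁻¹

theorem inversionConst_pos (n : ℕ) : 0 < inversionConst n := by
  unfold inversionConst
  positivity

theorem enorm_inversionConst_ne_zero (n : ℕ) : ‖inversionConst n‖ₑ ≠ 0 :=
  enorm_ne_zero.2 (inversionConst_pos n).ne'

theorem enorm_inversionConst_mul_two_pi_pow (n : ℕ) :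
    ‖inversionConst n‖ₑ * ENNReal.ofReal ((2 * Real.pi) ^ n) = 1 := by
  rw [Real.enorm_of_nonneg (inversionConst_pos n).le,
    ← ENNReal.ofReal_mul (inversionConst_pos n).le, inversionConst,
    inv_mul_cancel₀ (by positivity), ENNReal.ofReal_one]

theorem hatInv_apply (φ : 𝓢(Rn n, ℂ)) (η : Rn n) :
    hatInv n φ η =
      inversionConst n • ∫ x, Complex.exp (Complex.I * (inner ℝ x η : ℝ)) * φ x := by
  have dilation_symm (x : Rn n) : (dilation n).symm x = (2 * Real.pi) • x := by
    rw [ContinuousLinearEquiv.symm_apply_eq]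
    change x = (2 * Real.pi)⁻¹ • ((2 * Real.pi) • x)
    rw [inv_smul_smul₀ (by positivity)]
  have rescale := Measure.integral_comp_smul_of_nonneg (volume : Measure (Rn n))
    (fun x => Complex.exp (Complex.I * (inner ℝ x η : ℝ)) * φ x) (2 * Real.pi)
    (hR := by positivity)
  rw [finrank_euclideanSpace_fin] at rescale
  rw [inversionConst, ← rescale]
  change (𝓕⁻ (SchwartzMap.compCLMOfContinuousLinearEquiv ℂ (dilation n).symm φ)) η = _
  rw [SchwartzMap.fourierInv_coe, Real.fourierInv_eq']
  refine integral_congr_ae (.of_forall fun x => ?_)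
  simp only [SchwartzMap.compCLMOfContinuousLinearEquiv_apply, Function.comp, dilation_symm,
    smul_eq_mul, real_inner_smul_left]
  congr 2
  push_cast
  ring

theorem integral_hat_mul (φ : 𝓢(Rn n, ℂ)) {g : Rn n → ℂ} (hg : Integrable g) :
    ∫ x, hat n φ x * g x =
      ∫ ξ, φ ξ * ∫ x, Complex.exp (-Complex.I * (inner ℝ x ξ : ℝ)) * g x := by
  have h := VectorFourier.integral_fourierIntegral_smul_eq_flip (L := innerₗ (Rn n))
    (μ := volume) (ν := volume) Real.continuous_probChar (by exact continuous_inner) φ.integrable hg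
  rw [flip_innerₗ] at h
  simpa only [VectorFourier.fourierIntegral_probChar, smul_eq_mul, hat_apply, innerₗ_apply_apply,
    neg_mul, mul_comm Complex.I] using h

theorem hatInv_mul_hat (χ : Test n) (φ : 𝓢(Rn n, ℂ)) (η : Rn n) :
    hatInv n (mulTest χ (hat n φ)).toSchwartz η =
      inversionConst n • ∫ ξ, φ ξ * hat n χ.toSchwartz (ξ - η) := by
  have integrable_exp_mul :
      Integrable fun x => Complex.exp (Complex.I * (inner ℝ x η : ℝ)) * χ x := by
    refine χ.toSchwartz.integrable.bdd_mul (c := 1)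
      (Continuous.aestronglyMeasurable (by fun_prop)) (.of_forall fun x => ?_)
    rw [mul_comm, Complex.norm_exp_ofReal_mul_I]
  calc hatInv n (mulTest χ (hat n φ)).toSchwartz η
      = inversionConst n •
          ∫ x, hat n φ x * (Complex.exp (Complex.I * (inner ℝ x η : ℝ)) * χ x) := by
        simp only [hatInv_apply, Test.toSchwartz_apply, mulTest_apply, mul_comm (hat n φ _),
          mul_assoc]
    _ = inversionConst n • ∫ ξ, φ ξ * hat n χ.toSchwartz (ξ - η) := by
        rw [integral_hat_mul φ integrable_exp_mul]
        simp only [hat_apply, ← mul_assoc, ← Complex.exp_add, inner_sub_right,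
          Test.toSchwartz_apply]
        congr! 8
        push_cast
        ring

theorem hat_translate (y : Rn n) (χ : Test n) (ξ : Rn n) :
    hat n (translate y χ).toSchwartz ξ =
      Complex.exp (-Complex.I * (inner ℝ y ξ : ℝ)) * hat n χ.toSchwartz ξ := by
  rw [hat_apply, hat_apply, ← integral_const_mul, ← integral_add_right_eq_self _ y]
  refine integral_congr_ae (.of_forall fun x => ?_)
  simp only [Test.toSchwartz_apply, translate_apply, add_sub_cancel_right, inner_add_left]
  rw [← mul_assoc, ← Complex.exp_add]
  congr 2
  push_cast
  ring

/-! ### Weight functions of polynomial growth -/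

variable {k w : Rn n → ℝ}

/-- `w` is a temperate control weight for `k`: a smooth radially increasing function of temperate
growth with `k (ξ + η) ≤ w ξ * k η`. The example to keep in mind is `w ξ = C * ⟨ξ⟩ ^ N`. -/
structure IsControlWeight (w k : Rn n → ℝ) : Prop where
  pos : ∀ ξ, 0 < w ξ
  hasTemperateGrowth : w.HasTemperateGrowth
  le_of_norm_le : ∀ ξ η, ‖ξ‖ ≤ ‖η‖ → w ξ ≤ w η
  le_mul : ∀ ξ η, k (ξ + η) ≤ w ξ * k η

theorem IsWeight.exists_isControlWeight (hk : IsWeight k) : ∃ w, IsControlWeight w k := by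
  obtain ⟨C, N, hC, hN, growth⟩ := hk.growth
  refine ⟨fun ξ => C * Real.sqrt (1 + ‖ξ‖ ^ 2) ^ N, fun ξ => by positivity, ?_,
    fun ξ η hξη => by gcongr, growth⟩
  have sqrt_rpow (ξ : Rn n) : Real.sqrt (1 + ‖ξ‖ ^ 2) ^ N = (1 + ‖ξ‖ ^ 2) ^ (N / 2) := by
    rw [Real.sqrt_eq_rpow, ← Real.rpow_mul (by positivity)]
    ring_nf
  simp only [sqrt_rpow]
  fun_prop

theorem IsControlWeight.measurable (hw : IsControlWeight w k) : Measurable w :=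
  hw.hasTemperateGrowth.1.continuous.measurable

theorem IsControlWeight.isModerate (hw : IsControlWeight w k) (hk : IsWeight k) :
    IsModerate (‖w ·‖ₑ) (‖k ·‖ₑ) := fun ξ η => by
  rw [← enorm_mul, enorm_le_iff_norm_le, Real.norm_of_nonneg (hk.pos _).le]
  exact (hw.le_mul ξ η).trans (le_abs_self _)

theorem IsControlWeight.zero_le_mul (hw : IsControlWeight w k) (hk : IsWeight k) (ξ : Rn n) :
    k 0 ≤ w ξ * k ξ := by
  calc k 0 ≤ w (-ξ) * k ξ := by simpa only [neg_add_cancel] using hw.le_mul (-ξ) ξ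
    _ ≤ w ξ * k ξ :=
        mul_le_mul_of_nonneg_right (hw.le_of_norm_le _ _ (norm_neg ξ).le) (hk.pos ξ).le

theorem IsControlWeight.memLp_smul (hw : IsControlWeight w k) (φ : 𝓢(Rn n, ℂ)) (p : ℝ≥0∞) :
    MemLp (fun ξ => w ξ • φ ξ) p :=
  ((SchwartzMap.smulLeftCLM ℂ w φ).memLp p volume).ae_eq <| .of_forall <|
    SchwartzMap.smulLeftCLM_apply_apply hw.hasTemperateGrowth φ

theorem IsWeight.ofReal_ne_zero (hk : IsWeight k) (ξ : Rn n) : (k ξ : ℂ) ≠ 0 :=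
  Complex.ofReal_ne_zero.2 (hk.pos ξ).ne'

theorem IsWeight.measurable_ofReal (hk : IsWeight k) : Measurable fun ξ => (k ξ : ℂ) :=
  Complex.measurable_ofReal.comp hk.measurable

theorem IsWeight.memLp_schwartz_div (hk : IsWeight k) (φ : 𝓢(Rn n, ℂ)) (p : ℝ≥0∞) :
    MemLp (fun ξ => φ ξ / (k ξ : ℂ)) p := by
  obtain ⟨w, hw⟩ := hk.exists_isControlWeight
  refine (hw.memLp_smul φ p).of_le_mul (c := (k 0)⁻¹)
    (φ.continuous.measurable.div hk.measurable_ofReal).aestronglyMeasurable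
    (.of_forall fun ξ => ?_)
  rw [norm_div, Complex.norm_of_nonneg (hk.pos ξ).le, norm_smul,
    Real.norm_of_nonneg (hw.pos ξ).le, inv_mul_eq_div, div_le_div_iff₀ (hk.pos ξ) (hk.pos 0)]
  calc ‖φ ξ‖ * k 0 ≤ ‖φ ξ‖ * (w ξ * k ξ) := by gcongr; exact hw.zero_le_mul hk ξ
    _ = w ξ * ‖φ ξ‖ * k ξ := by ring

section

variable {f : Rn n → ℂ}

theorem IsWeight.integrable_schwartz_mul (hk : IsWeight k) (φ : 𝓢(Rn n, ℂ))
    (hf : MemLp (fun ξ => (k ξ : ℂ) * f ξ) 2) : Integrable (fun ξ => φ ξ * f ξ) := by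
  refine ((hk.memLp_schwartz_div φ 2).integrable_mul hf).congr (.of_forall fun ξ => ?_)
  simp only [Pi.mul_apply, ← mul_assoc, div_mul_cancel₀ _ (hk.ofReal_ne_zero ξ)]

theorem IsWeight.memLp_schwartz_mul (hk : IsWeight k) (φ : 𝓢(Rn n, ℂ)) {p : ℝ≥0∞}
    (hf : MemLp (fun ξ => (k ξ : ℂ) * f ξ) p) : MemLp (fun ξ => φ ξ * f ξ) p := by
  refine (hf.mul (hk.memLp_schwartz_div φ ⊤) (r := p)).ae_eq (.of_forall fun ξ => ?_)
  simp only [Pi.mul_apply, ← mul_assoc, div_mul_cancel₀ _ (hk.ofReal_ne_zero ξ)]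

theorem IsWeight.aestronglyMeasurable (hk : IsWeight k)
    (hf : AEStronglyMeasurable (fun ξ => (k ξ : ℂ) * f ξ)) : AEStronglyMeasurable f := by
  refine (hf.aemeasurable.div hk.measurable_ofReal.aemeasurable).aestronglyMeasurable.congr
    (.of_forall fun ξ => ?_)
  simp only [Pi.div_apply, mul_div_cancel_left₀ _ (hk.ofReal_ne_zero ξ)]

theorem IsControlWeight.memLp_inv_smul (hw : IsControlWeight w k) (hk : IsWeight k) {p : ℝ≥0∞}
    (hf : MemLp (fun ξ => (k ξ : ℂ) * f ξ) p) : MemLp (fun ξ => (w ξ)⁻¹ • f ξ) p := by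
  refine hf.of_le_mul (c := (k 0)⁻¹) (hw.measurable.inv.aestronglyMeasurable.smul
    (hk.aestronglyMeasurable hf.1)) (.of_forall fun ξ => ?_)
  rw [norm_smul, norm_inv, norm_mul, Complex.norm_of_nonneg (hk.pos ξ).le,
    Real.norm_of_nonneg (hw.pos ξ).le, inv_mul_eq_div, inv_mul_eq_div,
    div_le_div_iff₀ (hw.pos ξ) (hk.pos 0)]
  calc ‖f ξ‖ * k 0 ≤ ‖f ξ‖ * (w ξ * k ξ) := by gcongr; exact hw.zero_le_mul hk ξ
    _ = k ξ * ‖f ξ‖ * w ξ := by ring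

theorem IsWeight.locallyIntegrable (hk : IsWeight k) {p : ℝ≥0∞} (hp : 1 ≤ p)
    (hf : MemLp (fun ξ => (k ξ : ℂ) * f ξ) p) : LocallyIntegrable f := by
  obtain ⟨w, hw⟩ := hk.exists_isControlWeight
  have h := locallyIntegrable_iff.1 ((hw.memLp_inv_smul hk hf).locallyIntegrable hp)
  have smul_inv_smul : (fun ξ => w ξ • (w ξ)⁻¹ • f ξ) = f :=
    funext fun ξ => smul_inv_smul₀ (hw.pos ξ).ne' (f ξ)
  rw [← smul_inv_smul]
  exact locallyIntegrable_iff.2 fun K hK =>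
    (h K hK).continuousOn_smul hw.hasTemperateGrowth.1.continuous.continuousOn hK

end

/-! ### Functions representing tempered distributions -/

theorem IsFunction.ae_eq {T : 𝓢'(Rn n, ℂ)} {f g : Rn n → ℂ} (hf : IsFunction T f)
    (hg : IsFunction T g) : f =ᵐ[volume] g := by
  refine ae_eq_of_integral_contDiff_smul_eq hf.1 hg.1 fun φ φ_smooth φ_compact => ?_
  let Φ : 𝓢(Rn n, ℂ) := HasCompactSupport.toSchwartzMap (f := Complex.ofRealCLM ∘ φ)
    (φ_compact.comp_left rfl) (by fun_prop)
  exact (hf.2 Φ).2.symm.trans (hg.2 Φ).2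

theorem IsFunction.congr {T : 𝓢'(Rn n, ℂ)} {f g : Rn n → ℂ} (hf : IsFunction T f)
    (h : f =ᵐ[volume] g) : IsFunction T g := by
  have mul_ae_eq (φ : 𝓢(Rn n, ℂ)) : (fun ξ => φ ξ * f ξ) =ᵐ[volume] fun ξ => φ ξ * g ξ :=
    h.mono fun ξ hξ => congrArg (φ ξ * ·) hξ
  exact ⟨hf.1.congr h, fun φ => ⟨(hf.2 φ).1.congr (mul_ae_eq φ),
    (hf.2 φ).2.trans (integral_congr_ae (mul_ae_eq φ))⟩⟩

/-- `f` is a Borel measurable representative of `T̂` with `k f ∈ L²`; by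
`exists_isFourierDensity` it exists for every `T ∈ 𝓑_k`. -/
structure IsFourierDensity (k : Rn n → ℝ) (T : 𝓢'(Rn n, ℂ)) (f : Rn n → ℂ) : Prop where
  measurable : Measurable f
  isFunction : IsFunction (hatDistr T) f
  memLp : MemLp (fun ξ => (k ξ : ℂ) * f ξ) 2

section

variable {T : 𝓢'(Rn n, ℂ)} {f : Rn n → ℂ}

theorem exists_isFourierDensity (hT : T ∈ hormanderSpace k) : ∃ f, IsFourierDensity k T f := by
  obtain ⟨f, hf, hkf⟩ := hT
  have hm := hf.1.aestronglyMeasurable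
  exact ⟨hm.mk f, hm.stronglyMeasurable_mk.measurable, hf.congr hm.ae_eq_mk,
    hkf.ae_eq (hm.ae_eq_mk.mono fun ξ hξ => congrArg ((k ξ : ℂ) * ·) hξ)⟩

theorem IsFourierDensity.mem_hormanderSpace (hf : IsFourierDensity k T f) :
    T ∈ hormanderSpace k :=
  ⟨f, hf.isFunction, hf.memLp⟩

theorem IsFourierDensity.hormanderNorm_eq (hf : IsFourierDensity k T f) :
    hormanderNorm k T = eLpNorm (fun ξ => (k ξ : ℂ) * f ξ) 2 volume := by
  refine le_antisymm (iInf₂_le f hf.isFunction) (le_iInf₂ fun g hg => (eLpNorm_congr_ae ?_).le)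
  exact (hf.isFunction.ae_eq hg).mono fun ξ hξ => congrArg ((k ξ : ℂ) * ·) hξ

theorem hormanderNorm_lt_top (hT : T ∈ hormanderSpace k) : hormanderNorm k T < ⊤ := by
  obtain ⟨f, hf⟩ := exists_isFourierDensity hT
  exact hf.hormanderNorm_eq.trans_lt hf.memLp.2

theorem IsWeight.isFunction (hk : IsWeight k) (hf : MemLp (fun ξ => (k ξ : ℂ) * f ξ) 2)
    (h : ∀ φ : 𝓢(Rn n, ℂ), T φ = ∫ ξ, φ ξ * f ξ) : IsFunction T f :=
  ⟨hk.locallyIntegrable one_le_two hf, fun φ => ⟨hk.integrable_schwartz_mul φ hf, h φ⟩⟩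

end

/-! ### Products with test functions -/

variable {T : 𝓢'(Rn n, ℂ)} {f : Rn n → ℂ}

theorem enorm_ofReal_mul (r : ℝ) (z : ℂ) : ‖(r : ℂ) * z‖ₑ = ‖r‖ₑ * ‖z‖ₑ := by
  rw [← Complex.real_smul, enorm_smul]

/-- The function `(2π)⁻ⁿ χ̂ * f`, which is the Fourier transform of `χ T` if `f` is the Fourier
transform of `T`. -/
def prodHat (χ : Test n) (f : Rn n → ℂ) (ξ : Rn n) : ℂ :=
  inversionConst n • ∫ η, hat n χ.toSchwartz (ξ - η) * f η

theorem measurable_prodHat (χ : Test n) (hf : Measurable f) : Measurable (prodHat χ f) := by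
  have hφ := (hat n χ.toSchwartz).continuous.measurable
  have integrand_measurable :
      Measurable fun p : Rn n × Rn n => hat n χ.toSchwartz (p.1 - p.2) * f p.2 := by fun_prop
  exact integrand_measurable.stronglyMeasurable.integral_prod_right'.measurable.const_smul
    (inversionConst n)

theorem enorm_prodHat_le (χ : Test n) (f : Rn n → ℂ) (ξ : Rn n) :
    ‖prodHat χ f ξ‖ₑ ≤
      ‖inversionConst n‖ₑ * ∫⁻ η, ‖hat n χ.toSchwartz (ξ - η)‖ₑ * ‖f η‖ₑ := by
  rw [prodHat, enorm_smul]
  gcongr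
  simpa only [enorm_mul] using
    enorm_integral_le_lintegral_enorm fun η => hat n χ.toSchwartz (ξ - η) * f η

theorem IsControlWeight.lintegral_sq_convolution_le (hw : IsControlWeight w k) (hk : IsWeight k)
    (φ : 𝓢(Rn n, ℂ)) (hf : Measurable f) :
    ∫⁻ ξ, (‖k ξ‖ₑ * ∫⁻ η, ‖φ (ξ - η)‖ₑ * ‖f η‖ₑ) ^ 2 ≤
      (∫⁻ ζ, ‖w ζ • φ ζ‖ₑ) ^ 2 * eLpNorm (fun η => (k η : ℂ) * f η) 2 volume ^ 2 := by
  rw [← lintegral_enorm_sq_eq_eLpNorm_sq]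
  simpa only [enorm_smul, enorm_ofReal_mul] using
    (hw.isModerate hk).lintegral_sq_convolution_le (μ := volume) hw.measurable.enorm
      hk.measurable.enorm φ.continuous.measurable.enorm hf.enorm

/-- A bound for the norm of multiplication by `χ` on `𝓑_k` if `w` is a control weight for `k`. -/
def multiplierConst (w : Rn n → ℝ) (χ : Test n) : ℝ≥0∞ :=
  ‖inversionConst n‖ₑ * ∫⁻ ζ, ‖w ζ • hat n χ.toSchwartz ζ‖ₑ

theorem IsControlWeight.lintegral_enorm_smul_lt_top (hw : IsControlWeight w k)
    (φ : 𝓢(Rn n, ℂ)) : ∫⁻ ζ, ‖w ζ • φ ζ‖ₑ < ⊤ :=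
  (memLp_one_iff_integrable.1 (hw.memLp_smul φ 1)).2

theorem IsControlWeight.multiplierConst_lt_top (hw : IsControlWeight w k) (χ : Test n) :
    multiplierConst w χ < ⊤ :=
  ENNReal.mul_lt_top enorm_lt_top (hw.lintegral_enorm_smul_lt_top _)

theorem IsControlWeight.eLpNorm_prodHat_le (hw : IsControlWeight w k) (hk : IsWeight k)
    (χ : Test n) (hf : Measurable f) :
    eLpNorm (fun ξ => (k ξ : ℂ) * prodHat χ f ξ) 2 volume ≤
      multiplierConst w χ * eLpNorm (fun ξ => (k ξ : ℂ) * f ξ) 2 volume := by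
  rw [← ENNReal.pow_le_pow_left_iff (n := 2) two_ne_zero, ← lintegral_enorm_sq_eq_eLpNorm_sq]
  calc ∫⁻ ξ, ‖(k ξ : ℂ) * prodHat χ f ξ‖ₑ ^ 2
      ≤ ∫⁻ ξ, ‖inversionConst n‖ₑ ^ 2 *
          (‖k ξ‖ₑ * ∫⁻ η, ‖hat n χ.toSchwartz (ξ - η)‖ₑ * ‖f η‖ₑ) ^ 2 := by
        refine lintegral_mono fun ξ => ?_
        rw [← mul_pow, enorm_ofReal_mul, mul_left_comm]
        gcongr
        exact enorm_prodHat_le χ f ξ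
    _ ≤ ‖inversionConst n‖ₑ ^ 2 * ((∫⁻ ζ, ‖w ζ • hat n χ.toSchwartz ζ‖ₑ) ^ 2 *
          eLpNorm (fun ξ => (k ξ : ℂ) * f ξ) 2 volume ^ 2) := by
        rw [lintegral_const_mul' _ _ (ENNReal.pow_ne_top enorm_ne_top)]
        gcongr
        exact hw.lintegral_sq_convolution_le hk _ hf
    _ = (multiplierConst w χ * eLpNorm (fun ξ => (k ξ : ℂ) * f ξ) 2 volume) ^ 2 := by
        rw [multiplierConst]
        ring

theorem IsWeight.memLp_prodHat (hk : IsWeight k) (χ : Test n) (hf : Measurable f)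
    (hkf : MemLp (fun ξ => (k ξ : ℂ) * f ξ) 2) :
    MemLp (fun ξ => (k ξ : ℂ) * prodHat χ f ξ) 2 := by
  obtain ⟨w, hw⟩ := hk.exists_isControlWeight
  exact ⟨(hk.measurable_ofReal.mul (measurable_prodHat χ hf)).aestronglyMeasurable,
    (hw.eLpNorm_prodHat_le hk χ hf).trans_lt
      (ENNReal.mul_lt_top (hw.multiplierConst_lt_top χ) hkf.2)⟩

theorem IsWeight.integrable_mul_sub_mul (hk : IsWeight k) (φ ψ : 𝓢(Rn n, ℂ))
    (hf : Measurable f) (hkf : MemLp (fun ξ => (k ξ : ℂ) * f ξ) 2) :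
    Integrable (fun p : Rn n × Rn n => φ p.1 * (ψ (p.1 - p.2) * f p.2))
      (volume.prod volume) := by
  obtain ⟨w, hw⟩ := hk.exists_isControlWeight
  have hφ := φ.continuous.measurable
  have hψ := ψ.continuous.measurable
  have hconv : Measurable fun ξ => ∫⁻ η, ‖ψ (ξ - η)‖ₑ * ‖f η‖ₑ :=
    Measurable.lintegral_prod_right' (f := fun p : Rn n × Rn n => ‖ψ (p.1 - p.2)‖ₑ * ‖f p.2‖ₑ)
      (by fun_prop)
  have hm : Measurable fun p : Rn n × Rn n => φ p.1 * (ψ (p.1 - p.2) * f p.2) := by fun_prop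
  refine ⟨hm.aestronglyMeasurable, ?_⟩
  have cauchy_schwarz : (∫⁻ ξ, ∫⁻ η, ‖φ ξ * (ψ (ξ - η) * f η)‖ₑ) ^ 2 ≤
      (∫⁻ ξ, ‖φ ξ / (k ξ : ℂ)‖ₑ ^ 2) *
        ∫⁻ ξ, (‖k ξ‖ₑ * ∫⁻ η, ‖ψ (ξ - η)‖ₑ * ‖f η‖ₑ) ^ 2 := by
    refine le_of_eq_of_le (congrArg (· ^ 2) (lintegral_congr fun ξ => ?_))
      (sq_lintegral_mul_le (hφ.div hk.measurable_ofReal).enorm.aemeasurable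
        (hk.measurable.enorm.mul hconv).aemeasurable)
    simp only [enorm_mul]
    rw [lintegral_const_mul _ (by fun_prop), mul_left_comm, ← mul_assoc, ← enorm_ofReal_mul,
      mul_div_cancel₀ _ (hk.ofReal_ne_zero ξ)]
  rw [hasFiniteIntegral_iff_enorm, lintegral_prod _ hm.enorm.aemeasurable]
  refine ((ENNReal.pow_lt_top_iff (n := 2)).1 (cauchy_schwarz.trans_lt
    (ENNReal.mul_lt_top ?_ ?_))).resolve_right two_ne_zero
  · rw [lintegral_enorm_sq_eq_eLpNorm_sq]
    exact ENNReal.pow_lt_top (hk.memLp_schwartz_div φ 2).2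
  · exact (hw.lintegral_sq_convolution_le hk ψ hf).trans_lt (ENNReal.mul_lt_top
      (ENNReal.pow_lt_top (hw.lintegral_enorm_smul_lt_top ψ)) (ENNReal.pow_lt_top hkf.2))

theorem IsFourierDensity.prodHat (hf : IsFourierDensity k T f) (hk : IsWeight k) (χ : Test n) :
    IsFourierDensity k (smulDistr χ (restrict T)) (prodHat χ f) := by
  have hmem := hk.memLp_prodHat χ hf.measurable hf.memLp
  refine ⟨measurable_prodHat χ hf.measurable, hk.isFunction hmem fun φ => ?_, hmem⟩
  have pairing : hatDistr (smulDistr χ (restrict T)) φ =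
      hatDistr T (hatInv n (mulTest χ (hat n φ)).toSchwartz) := by
    rw [hatDistr_apply, hatDistr_apply, hat_hatInv]
    rfl
  calc hatDistr (smulDistr χ (restrict T)) φ
      = ∫ η, hatInv n (mulTest χ (hat n φ)).toSchwartz η * f η :=
        pairing.trans (hf.isFunction.2 _).2
    _ = inversionConst n • ∫ η, ∫ ξ, φ ξ * (hat n χ.toSchwartz (ξ - η) * f η) := by
        rw [← integral_smul]
        simp only [hatInv_mul_hat, smul_mul_assoc, ← integral_mul_const, mul_assoc]
    _ = inversionConst n • ∫ ξ, ∫ η, φ ξ * (hat n χ.toSchwartz (ξ - η) * f η) :=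
        congrArg (inversionConst n • ·) (integral_integral_swap
          (hk.integrable_mul_sub_mul φ (hat n χ.toSchwartz) hf.measurable hf.memLp)).symm
    _ = ∫ ξ, φ ξ * Kato.prodHat χ f ξ := by
        simp only [Kato.prodHat, integral_const_mul, mul_smul_comm, integral_smul]

theorem IsWeight.smulDistr_mem (hk : IsWeight k) (χ : Test n) (hT : T ∈ hormanderSpace k) :
    smulDistr χ (restrict T) ∈ hormanderSpace k := by
  obtain ⟨f, hf⟩ := exists_isFourierDensity hT
  exact (hf.prodHat hk χ).mem_hormanderSpace

theorem IsControlWeight.hormanderNorm_smulDistr_le (hw : IsControlWeight w k) (hk : IsWeight k)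
    (χ : Test n) (hT : T ∈ hormanderSpace k) :
    hormanderNorm k (smulDistr χ (restrict T)) ≤ multiplierConst w χ * hormanderNorm k T := by
  obtain ⟨f, hf⟩ := exists_isFourierDensity hT
  rw [hf.hormanderNorm_eq, (hf.prodHat hk χ).hormanderNorm_eq]
  exact hw.eLpNorm_prodHat_le hk χ hf.measurable

/-! ### The control function of an element of `𝓑_k` -/

theorem exists_schwartz_sub_left {E F : Type*} [NormedAddCommGroup E] [NormedSpace ℝ E]
    [NormedAddCommGroup F] [NormedSpace ℝ F] (φ : 𝓢(E, F)) (x : E) :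
    ∃ ψ : 𝓢(E, F), ∀ y, ψ y = φ (x - y) := by
  refine ⟨SchwartzMap.compCLMOfContinuousLinearEquiv ℝ (ContinuousLinearEquiv.neg ℝ)
    (SchwartzMap.compSubConstCLM ℝ (-x) φ), fun y => ?_⟩
  simp [sub_eq_add_neg, add_comm]

/-- The short-time Fourier transform `∫ e^{i⟨y, η⟩} φ(ξ - η) f(η) dη` of `f` with window `φ`. -/
def windowedFourier (φ : 𝓢(Rn n, ℂ)) (f : Rn n → ℂ) (y ξ : Rn n) : ℂ :=
  ∫ η, Complex.exp (Complex.I * (inner ℝ y η : ℝ)) • (φ (ξ - η) * f η)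

theorem measurable_windowedFourier (φ : 𝓢(Rn n, ℂ)) (hf : Measurable f) :
    Measurable fun p : Rn n × Rn n => windowedFourier φ f p.1 p.2 := by
  have hφ := φ.continuous.measurable
  have exp_measurable : Measurable fun p : (Rn n × Rn n) × Rn n =>
      Complex.exp (Complex.I * (inner ℝ p.1.1 p.2 : ℝ)) := Continuous.measurable (by fun_prop)
  have integrand_measurable : Measurable fun p : (Rn n × Rn n) × Rn n =>
      Complex.exp (Complex.I * (inner ℝ p.1.1 p.2 : ℝ)) • (φ (p.1.2 - p.2) * f p.2) :=
    exp_measurable.smul (by fun_prop)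
  exact integrand_measurable.stronglyMeasurable.integral_prod_right'.measurable

theorem enorm_prodHat_translate (y : Rn n) (χ : Test n) (f : Rn n → ℂ) (ξ : Rn n) :
    ‖prodHat (translate y χ) f ξ‖ₑ =
      ‖inversionConst n‖ₑ * ‖windowedFourier (hat n χ.toSchwartz) f y ξ‖ₑ := by
  have modulation : ∫ η, hat n (translate y χ).toSchwartz (ξ - η) * f η =
      Complex.exp (-Complex.I * (inner ℝ y ξ : ℝ)) *
        windowedFourier (hat n χ.toSchwartz) f y ξ := by
    rw [windowedFourier, ← integral_const_mul]
    refine integral_congr_ae (.of_forall fun η => ?_)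
    simp only [hat_translate, inner_sub_right, smul_eq_mul]
    rw [← mul_assoc, ← mul_assoc, ← Complex.exp_add]
    congr 3
    push_cast
    ring
  have enorm_exp : ‖Complex.exp (-Complex.I * (inner ℝ y ξ : ℝ))‖ₑ = 1 := by
    rw [← ofReal_norm, Complex.norm_exp]
    simp
  rw [prodHat, modulation, enorm_smul, enorm_mul, enorm_exp, one_mul]

theorem IsWeight.lintegral_enorm_sq_windowedFourier (hk : IsWeight k) (φ : 𝓢(Rn n, ℂ))
    (hf : MemLp (fun ξ => (k ξ : ℂ) * f ξ) 2) (ξ : Rn n) :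
    ∫⁻ y, ‖windowedFourier φ f y ξ‖ₑ ^ 2 =
      ENNReal.ofReal ((2 * Real.pi) ^ n) * ∫⁻ η, (‖φ (ξ - η)‖ₑ * ‖f η‖ₑ) ^ 2 := by
  obtain ⟨ψ, hψ⟩ := exists_schwartz_sub_left φ ξ
  have plancherel := lintegral_enorm_sq_integral_exp_inner
    (hk.integrable_schwartz_mul ψ hf) (hk.memLp_schwartz_mul ψ hf)
  simpa only [windowedFourier, hψ, enorm_mul, finrank_euclideanSpace_fin] using plancherel

theorem IsFourierDensity.control_sq_eq (hf : IsFourierDensity k T f) (hk : IsWeight k)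
    (χ : Test n) (y : Rn n) :
    control k χ (restrict T) y ^ 2 = ‖inversionConst n‖ₑ ^ 2 *
      ∫⁻ ξ, (‖k ξ‖ₑ * ‖windowedFourier (hat n χ.toSchwartz) f y ξ‖ₑ) ^ 2 := by
  rw [control, (hf.prodHat hk _).hormanderNorm_eq, ← lintegral_enorm_sq_eq_eLpNorm_sq,
    ← lintegral_const_mul' _ _ (ENNReal.pow_ne_top enorm_ne_top)]
  refine lintegral_congr fun ξ => ?_
  rw [enorm_ofReal_mul, enorm_prodHat_translate, mul_left_comm, mul_pow]

theorem IsWeight.measurable_control (hk : IsWeight k) (χ : Test n) (hT : T ∈ hormanderSpace k) :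
    Measurable (control k χ (restrict T)) := by
  obtain ⟨f, hf⟩ := exists_isFourierDensity hT
  have hkm := hk.measurable
  have hW := measurable_windowedFourier (hat n χ.toSchwartz) hf.measurable
  have control_sq_measurable : Measurable fun y => control k χ (restrict T) y ^ 2 := by
    simp only [hf.control_sq_eq hk]
    exact (Measurable.lintegral_prod_right' (f := fun p : Rn n × Rn n =>
      (‖k p.2‖ₑ * ‖windowedFourier (hat n χ.toSchwartz) f p.1 p.2‖ₑ) ^ 2)
      (by fun_prop)).const_mul _
  have eq_sqrt : control k χ (restrict T) =
      fun y => (control k χ (restrict T) y ^ 2) ^ (1 / 2 : ℝ) := by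
    funext y
    rw [← ENNReal.rpow_natCast, ← ENNReal.rpow_mul]
    norm_num
  rw [eq_sqrt]
  exact control_sq_measurable.pow_const _

theorem IsFourierDensity.katoNorm_sq_eq (hf : IsFourierDensity k T f) (hk : IsWeight k)
    (χ : Test n) :
    katoNorm k 2 χ (restrict T) ^ 2 = ‖inversionConst n‖ₑ *
      ∫⁻ η, (∫⁻ ξ, (‖k ξ‖ₑ * ‖hat n χ.toSchwartz (ξ - η)‖ₑ) ^ 2) * ‖f η‖ₑ ^ 2 := by
  set φ := hat n χ.toSchwartz
  have hkm := hk.measurable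
  have hfm := hf.measurable
  have hW := measurable_windowedFourier φ hfm
  have plancherel (ξ : Rn n) : ∫⁻ y, (‖k ξ‖ₑ * ‖windowedFourier φ f y ξ‖ₑ) ^ 2 =
      ENNReal.ofReal ((2 * Real.pi) ^ n) *
        ∫⁻ η, (‖k ξ‖ₑ * ‖φ (ξ - η)‖ₑ) ^ 2 * ‖f η‖ₑ ^ 2 := by
    simp only [mul_pow, mul_assoc]
    rw [lintegral_const_mul' _ _ (ENNReal.pow_ne_top enorm_ne_top),
      lintegral_const_mul' _ _ (ENNReal.pow_ne_top enorm_ne_top),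
      hk.lintegral_enorm_sq_windowedFourier φ hf.memLp, mul_left_comm]
    simp only [mul_pow]
  calc katoNorm k 2 χ (restrict T) ^ 2
      = ‖inversionConst n‖ₑ ^ 2 *
          ∫⁻ y, ∫⁻ ξ, (‖k ξ‖ₑ * ‖windowedFourier φ f y ξ‖ₑ) ^ 2 := by
        rw [katoNorm, ← lintegral_enorm_sq_eq_eLpNorm_sq,
          ← lintegral_const_mul' _ _ (ENNReal.pow_ne_top enorm_ne_top)]
        exact lintegral_congr fun y => hf.control_sq_eq hk χ y
    _ = ‖inversionConst n‖ₑ ^ 2 * (ENNReal.ofReal ((2 * Real.pi) ^ n) *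
          ∫⁻ ξ, ∫⁻ η, (‖k ξ‖ₑ * ‖φ (ξ - η)‖ₑ) ^ 2 * ‖f η‖ₑ ^ 2) := by
        rw [lintegral_lintegral_swap (by fun_prop), lintegral_congr plancherel,
          lintegral_const_mul' _ _ ENNReal.ofReal_ne_top]
    _ = ‖inversionConst n‖ₑ *
          ∫⁻ η, (∫⁻ ξ, (‖k ξ‖ₑ * ‖φ (ξ - η)‖ₑ) ^ 2) * ‖f η‖ₑ ^ 2 := by
        rw [← mul_assoc, sq, mul_assoc ‖inversionConst n‖ₑ, enorm_inversionConst_mul_two_pi_pow,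
          mul_one, lintegral_lintegral_swap (by fun_prop)]
        exact congrArg _ (lintegral_congr fun η =>
          lintegral_mul_const' _ _ (ENNReal.pow_ne_top enorm_ne_top))

theorem IsControlWeight.katoNorm_sq_le (hw : IsControlWeight w k) (hk : IsWeight k) (χ : Test n)
    (hT : T ∈ hormanderSpace k) :
    katoNorm k 2 χ (restrict T) ^ 2 ≤
      ‖inversionConst n‖ₑ * (∫⁻ ζ, ‖w ζ • hat n χ.toSchwartz ζ‖ₑ ^ 2) *
        hormanderNorm k T ^ 2 := by
  obtain ⟨f, hf⟩ := exists_isFourierDensity hT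
  have hkm := hk.measurable
  have hfm := hf.measurable
  rw [hf.katoNorm_sq_eq hk, hf.hormanderNorm_eq, ← lintegral_enorm_sq_eq_eLpNorm_sq, mul_assoc]
  refine mul_le_mul_right ?_ _
  rw [← lintegral_const_mul _ (by fun_prop)]
  refine lintegral_mono fun η => ?_
  simp only [enorm_smul]
  rw [enorm_ofReal_mul, mul_pow, ← mul_assoc]
  gcongr
  exact (hw.isModerate hk).lintegral_sq_mul_sub_le hw.measurable.enorm
    (hat n χ.toSchwartz).continuous.measurable.enorm η

theorem IsControlWeight.mul_hormanderNorm_sq_le (hw : IsControlWeight w k) (hk : IsWeight k)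
    (χ : Test n) (hT : T ∈ hormanderSpace k) :
    ‖inversionConst n‖ₑ * (∫⁻ ζ, (‖hat n χ.toSchwartz ζ‖ₑ / ‖w (-ζ)‖ₑ) ^ 2) *
      hormanderNorm k T ^ 2 ≤ katoNorm k 2 χ (restrict T) ^ 2 := by
  obtain ⟨f, hf⟩ := exists_isFourierDensity hT
  have hkm := hk.measurable
  have hfm := hf.measurable
  rw [hf.katoNorm_sq_eq hk, hf.hormanderNorm_eq, ← lintegral_enorm_sq_eq_eLpNorm_sq, mul_assoc]
  refine mul_le_mul_right ?_ _
  rw [← lintegral_const_mul _ (by fun_prop)]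
  refine lintegral_mono fun η => ?_
  rw [enorm_ofReal_mul, mul_pow, ← mul_assoc]
  gcongr
  exact (hw.isModerate hk).mul_sq_le_lintegral_sq_mul_sub hw.measurable.enorm
    (hat n χ.toSchwartz).continuous.measurable.enorm η

theorem hat_toSchwartz_ne_zero {χ : Test n} (hχ : χ ≠ 0) : hat n χ.toSchwartz ≠ 0 := by
  intro h
  have toSchwartz_eq_zero : χ.toSchwartz = 0 := by
    rw [← hatInv_hat χ.toSchwartz, h, map_zero]
  exact hχ (DFunLike.ext _ _ fun x => DFunLike.congr_fun toSchwartz_eq_zero x)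

theorem IsControlWeight.lintegral_sq_enorm_div_ne_zero (hw : IsControlWeight w k)
    {φ : 𝓢(Rn n, ℂ)} (hφ : φ ≠ 0) : ∫⁻ ζ, (‖φ ζ‖ₑ / ‖w (-ζ)‖ₑ) ^ 2 ≠ 0 := by
  have hφm := φ.continuous.measurable
  have hwm := hw.measurable
  intro h
  have ae_zero : φ =ᵐ[volume] 0 := by
    filter_upwards [(lintegral_eq_zero_iff (by fun_prop)).1 h] with ζ hζ
    simpa using hζ
  exact hφ (DFunLike.coe_injective
    ((φ.continuous.ae_eq_iff_eq volume continuous_zero).1 ae_zero))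

theorem le_mul_of_sq_le_mul_sq {a b M D : ℝ≥0∞} (h : a ^ 2 ≤ M * b ^ 2) (hM : M ≤ D)
    (hD : 1 ≤ D) : a ≤ D * b := by
  rw [← ENNReal.pow_le_pow_left_iff (n := 2) two_ne_zero, mul_pow]
  exact h.trans (mul_le_mul_left (hM.trans (le_self_pow₀ hD two_ne_zero)) _)

theorem IsWeight.exists_norm_equiv (hk : IsWeight k) {χ : Test n} (hχ : χ ≠ 0) :
    ∃ C : ℝ≥0, 0 < C ∧ ∀ T ∈ hormanderSpace k,
      katoNorm k 2 χ (restrict T) ≤ C * hormanderNorm k T ∧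
      hormanderNorm k T ≤ C * katoNorm k 2 χ (restrict T) := by
  obtain ⟨w, hw⟩ := hk.exists_isControlWeight
  let A := ‖inversionConst n‖ₑ * ∫⁻ ζ, ‖w ζ • hat n χ.toSchwartz ζ‖ₑ ^ 2
  let B := ‖inversionConst n‖ₑ * ∫⁻ ζ, (‖hat n χ.toSchwartz ζ‖ₑ / ‖w (-ζ)‖ₑ) ^ 2
  have hA : A ≠ ⊤ := by
    refine ENNReal.mul_ne_top enorm_ne_top ?_
    rw [lintegral_enorm_sq_eq_eLpNorm_sq]
    exact ENNReal.pow_ne_top (hw.memLp_smul _ 2).2.ne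
  have hB : B ≠ 0 := mul_ne_zero (enorm_inversionConst_ne_zero n)
    (hw.lintegral_sq_enorm_div_ne_zero (hat_toSchwartz_ne_zero hχ))
  let D := max (max A B⁻¹) 1
  have hD : D ≠ ⊤ := by simp [D, hA, hB]
  refine ⟨D.toNNReal, ENNReal.toNNReal_pos (by simp [D]) hD, fun T hT => ?_⟩
  rw [ENNReal.coe_toNNReal hD]
  have kato_le : katoNorm k 2 χ (restrict T) ^ 2 ≤ A * hormanderNorm k T ^ 2 :=
    hw.katoNorm_sq_le hk χ hT
  have le_kato : hormanderNorm k T ^ 2 ≤ B⁻¹ * katoNorm k 2 χ (restrict T) ^ 2 := by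
    have kato_ne_top : katoNorm k 2 χ (restrict T) ^ 2 ≠ ⊤ := ne_top_of_le_ne_top
      (ENNReal.mul_ne_top hA (ENNReal.pow_ne_top (hormanderNorm_lt_top hT).ne)) kato_le
    rw [mul_comm, ← div_eq_mul_inv, ENNReal.le_div_iff_mul_le (.inl hB) (.inr kato_ne_top),
      mul_comm]
    exact hw.mul_hormanderNorm_sq_le hk χ hT
  exact ⟨le_mul_of_sq_le_mul_sq kato_le (le_max_of_le_left (le_max_left _ _)) (le_max_right _ _),
    le_mul_of_sq_le_mul_sq le_kato (le_max_of_le_left (le_max_right _ _)) (le_max_right _ _)⟩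

theorem IsWeight.memLp_control (hk : IsWeight k) {χ : Test n} (hχ : χ ≠ 0)
    (hT : T ∈ hormanderSpace k) : MemLp (control k χ (restrict T)) 2 := by
  obtain ⟨C, -, h⟩ := hk.exists_norm_equiv hχ
  exact ⟨(hk.measurable_control χ hT).aestronglyMeasurable, (h T hT).1.trans_lt
    (ENNReal.mul_lt_top ENNReal.coe_lt_top (hormanderNorm_lt_top hT))⟩

/-! ### Local membership in `𝓑_k` -/

theorem zero_mem_hormanderSpace : (0 : 𝓢'(Rn n, ℂ)) ∈ hormanderSpace k :=
  ⟨0, ⟨locallyIntegrable_zero, fun φ => ⟨by simp, by simp [hatDistr_apply]⟩⟩, by simp⟩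

theorem add_mem_hormanderSpace {S T : 𝓢'(Rn n, ℂ)} (hS : S ∈ hormanderSpace k)
    (hT : T ∈ hormanderSpace k) : S + T ∈ hormanderSpace k := by
  obtain ⟨f, ⟨hf_loc, hf⟩, hf_memLp⟩ := hS
  obtain ⟨g, ⟨hg_loc, hg⟩, hg_memLp⟩ := hT
  refine ⟨f + g, ⟨hf_loc.add hg_loc, fun φ => ?_⟩, ?_⟩
  · simp only [Pi.add_apply, mul_add]
    refine ⟨(hf φ).1.add (hg φ).1, ?_⟩
    rw [integral_add (hf φ).1 (hg φ).1, ← (hf φ).2, ← (hg φ).2]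
    rfl
  · simp only [Pi.add_apply, mul_add]
    exact hf_memLp.add hg_memLp

theorem sum_mem_hormanderSpace {ι : Type*} (t : Finset ι) (S : ι → 𝓢'(Rn n, ℂ))
    (hS : ∀ i ∈ t, S i ∈ hormanderSpace k) : ∑ i ∈ t, S i ∈ hormanderSpace k :=
  Finset.sum_induction S (· ∈ hormanderSpace k) (fun _ _ => add_mem_hormanderSpace)
    zero_mem_hormanderSpace hS

theorem smulDistr_eq_sum {ι : Type*} (t : Finset ι) {φ : Test n} {ψ χ : ι → Test n}
    (h : ∀ x, φ x = ∑ i ∈ t, ψ i x * χ i x) (u : Distr n) :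
    smulDistr φ u = ∑ i ∈ t, smulDistr (ψ i) (restrict (smulDistr (χ i) u)) := by
  ext g
  have mulTest_eq_sum :
      mulTest φ g = ∑ i ∈ t, mulTest (χ i) (mulTest (ψ i) g).toSchwartz := by
    ext x
    rw [mulTest_apply, h, Finset.sum_mul, sum_apply]
    refine Finset.sum_congr rfl fun i _ => ?_
    rw [mulTest_apply, Test.toSchwartz_apply, mulTest_apply]
    ring
  rw [smulDistr_apply, mulTest_eq_sum, map_sum, sum_apply]
  rfl

theorem contDiff_div_of_ne_zero_on_tsupport {𝕜 E 𝕜' : Type*} [NontriviallyNormedField 𝕜]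
    [NormedAddCommGroup E] [NormedSpace 𝕜 E] [NormedField 𝕜'] [NormedAlgebra 𝕜 𝕜']
    {m : WithTop ℕ∞} {f g : E → 𝕜'} (hf : ContDiff 𝕜 m f) (hg : ContDiff 𝕜 m g)
    (h : ∀ x ∈ tsupport f, g x ≠ 0) : ContDiff 𝕜 m fun x => f x / g x := by
  refine contDiff_iff_contDiffAt.2 fun x => ?_
  by_cases hx : x ∈ tsupport f
  · simp only [div_eq_mul_inv]
    exact hf.contDiffAt.mul (hg.contDiffAt.inv (h x hx))
  · refine (contDiffAt_const (c := (0 : 𝕜'))).congr_of_eventuallyEq ?_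
    filter_upwards [notMem_tsupport_iff_eventuallyEq.1 hx] with z hz
    simp [hz]

theorem exists_eq_sum_mul_of_tsupport_subset {ι : Type*} {t : Finset ι} {χ : ι → Test n}
    {φ : Test n} (h : ∀ x ∈ tsupport φ, ∃ i ∈ t, χ i x ≠ 0) :
    ∃ ψ : ι → Test n, ∀ x, φ x = ∑ i ∈ t, ψ i x * χ i x := by
  let s (x : Rn n) : ℂ := ∑ i ∈ t, starRingEnd ℂ (χ i x) * χ i x
  have conj_contDiff (i : ι) : ContDiff ℝ ∞ fun x => starRingEnd ℂ (χ i x) :=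
    Complex.conjCLE.contDiff.comp (χ i).contDiff
  have s_contDiff : ContDiff ℝ ∞ s :=
    ContDiff.sum fun i _ => (conj_contDiff i).mul (χ i).contDiff
  have s_ne_zero (x : Rn n) (hx : x ∈ tsupport φ) : s x ≠ 0 := by
    have s_eq : s x = ((∑ i ∈ t, ‖χ i x‖ ^ 2 : ℝ) : ℂ) := by
      simp only [s, Complex.conj_mul']
      push_cast
      rfl
    obtain ⟨i, hi, hix⟩ := h x hx
    rw [s_eq, Complex.ofReal_ne_zero]
    exact (Finset.sum_pos' (fun _ _ => by positivity)
      ⟨i, hi, pow_pos (norm_pos_iff.2 hix) 2⟩).ne'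
  let ψ (i : ι) : Test n :=
    { toFun := fun x => φ x / s x * starRingEnd ℂ (χ i x)
      contDiff' := (contDiff_div_of_ne_zero_on_tsupport φ.contDiff s_contDiff s_ne_zero).mul
        (conj_contDiff i)
      hasCompactSupport' := φ.hasCompactSupport.mono fun x hx hφ => hx (by simp [hφ])
      tsupport_subset' := Set.subset_univ _ }
  refine ⟨ψ, fun x => ?_⟩
  have sum_eq : ∑ i ∈ t, ψ i x * χ i x = φ x / s x * s x := by
    rw [Finset.mul_sum]
    exact Finset.sum_congr rfl fun i _ => mul_assoc _ _ _
  rw [sum_eq]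
  by_cases hx : x ∈ tsupport φ
  · rw [div_mul_cancel₀ _ (s_ne_zero x hx)]
  · simp [image_eq_zero_of_notMem_tsupport hx]

theorem exists_eq_sum_mul_translate {χ : Test n} (hχ : χ ≠ 0) (φ : Test n) :
    ∃ (t : Finset (Rn n)) (ψ : Rn n → Test n),
      ∀ x, φ x = ∑ y ∈ t, ψ y x * translate y χ x := by
  obtain ⟨x₀, hx₀⟩ : ∃ x, χ x ≠ 0 := by
    by_contra! h
    exact hχ (TestFunction.ext h)
  obtain ⟨t, ht⟩ := φ.hasCompactSupport.elim_finite_subcover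
    (fun y : Rn n => {x | translate y χ x ≠ 0})
    (fun y => isOpen_ne_fun (translate y χ).continuous continuous_const)
    (fun x _ => Set.mem_iUnion.2 ⟨x - x₀, by simpa [translate_apply] using hx₀⟩)
  obtain ⟨ψ, hψ⟩ := exists_eq_sum_mul_of_tsupport_subset (t := t) (χ := fun y => translate y χ)
    fun x hx => by simpa using ht hx
  exact ⟨t, ψ, hψ⟩

theorem IsWeight.mem_hormanderLoc (hk : IsWeight k) {χ : Test n} (hχ : χ ≠ 0) {u : Distr n}
    (hu : ∀ y, smulDistr (translate y χ) u ∈ hormanderSpace k) : u ∈ hormanderLoc k := by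
  intro φ
  obtain ⟨t, ψ, h⟩ := exists_eq_sum_mul_translate hχ φ
  rw [smulDistr_eq_sum t h]
  exact sum_mem_hormanderSpace t _ fun y _ => hk.smulDistr_mem _ (hu y)

/-! ### Cutoff functions -/

/-- The dilate `x ↦ χ(x / R)` of a test function; the multiplier norms of large dilates are
uniformly bounded. -/
def dilateTest (R : ℝ) (hR : R ≠ 0) (χ : Test n) : Test n where
  toFun x := χ (R⁻¹ • x)
  contDiff' := χ.contDiff.comp (contDiff_const_smul _)
  hasCompactSupport' := by
    simpa only [Function.comp_def, Homeomorph.smulOfNeZero_apply] using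
      χ.hasCompactSupport.comp_homeomorph (Homeomorph.smulOfNeZero R⁻¹ (inv_ne_zero hR))
  tsupport_subset' := Set.subset_univ _

theorem dilateTest_apply (R : ℝ) (hR : R ≠ 0) (χ : Test n) (x : Rn n) :
    dilateTest R hR χ x = χ (R⁻¹ • x) := rfl

theorem hat_dilateTest (R : ℝ) (hR : R ≠ 0) (χ : Test n) (ξ : Rn n) :
    hat n (dilateTest R hR χ).toSchwartz ξ = |R ^ n| • hat n χ.toSchwartz (R • ξ) := by
  have h := Measure.integral_comp_smul (volume : Measure (Rn n))
    (fun x => Complex.exp (-Complex.I * (inner ℝ x (R • ξ) : ℝ)) * χ x) R⁻¹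
  rw [finrank_euclideanSpace_fin, inv_pow, inv_inv] at h
  rw [hat_apply, hat_apply]
  refine (integral_congr_ae (.of_forall fun x => ?_)).trans h
  simp only [Test.toSchwartz_apply, dilateTest_apply, inner_smul_left, inner_smul_right]
  simp [hR]

theorem IsControlWeight.multiplierConst_dilateTest_le (hw : IsControlWeight w k) {R : ℝ}
    (hR₀ : R ≠ 0) (hR : 1 ≤ |R|) (χ : Test n) :
    multiplierConst w (dilateTest R hR₀ χ) ≤ multiplierConst w χ := by
  have enorm_le (ζ : Rn n) : ‖w ζ • hat n (dilateTest R hR₀ χ).toSchwartz ζ‖ₑ ≤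
      ENNReal.ofReal |R ^ n| * ‖w (R • ζ) • hat n χ.toSchwartz (R • ζ)‖ₑ := by
    have w_le : w ζ ≤ w (R • ζ) := hw.le_of_norm_le _ _ <| by
      rw [norm_smul]
      exact le_mul_of_one_le_left (norm_nonneg ζ) hR
    rw [hat_dilateTest, smul_comm, enorm_smul |R ^ n|, Real.enorm_of_nonneg (abs_nonneg _),
      enorm_smul, enorm_smul, Real.enorm_of_nonneg (hw.pos _).le,
      Real.enorm_of_nonneg (hw.pos _).le]
    gcongr
  refine mul_le_mul_right ((lintegral_mono enorm_le).trans_eq ?_) _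
  rw [lintegral_const_mul' _ _ ENNReal.ofReal_ne_top,
    lintegral_comp_smul volume (fun ζ => ‖w ζ • hat n χ.toSchwartz ζ‖ₑ) hR₀,
    finrank_euclideanSpace_fin, ← mul_assoc, ← ENNReal.ofReal_mul (abs_nonneg _), ← abs_mul,
    mul_inv_cancel₀ (pow_ne_zero n hR₀), abs_one, ENNReal.ofReal_one, one_mul]

theorem exists_test_eq_one (n : ℕ) : ∃ θ : Test n, ∀ x, ‖x‖ ≤ 1 → θ x = 1 := by
  let b : ContDiffBump (0 : Rn n) := ⟨1, 2, one_pos, one_lt_two⟩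
  refine ⟨⟨fun x => (b x : ℂ), Complex.ofRealCLM.contDiff.comp b.contDiff,
    b.hasCompactSupport.comp_left (g := Complex.ofReal) rfl, Set.subset_univ _⟩, fun x hx => ?_⟩
  have b_eq_one : b x = 1 := b.one_of_mem_closedBall (mem_closedBall_zero_iff.2 hx)
  exact congrArg Complex.ofReal b_eq_one

theorem exists_test_ne_zero (n : ℕ) : ∃ θ : Test n, θ ≠ 0 := by
  obtain ⟨θ, hθ⟩ := exists_test_eq_one n
  exact ⟨θ, fun h => one_ne_zero ((hθ 0 (by simp)).symm.trans (DFunLike.congr_fun h 0))⟩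

theorem IsControlWeight.exists_cutoff (hw : IsControlWeight w k) :
    ∃ M : ℝ≥0∞, M ≠ ⊤ ∧ ∀ φ : Test n, ∃ θ : Test n,
      (∀ x, θ x * φ x = φ x) ∧ multiplierConst w θ ≤ M := by
  obtain ⟨θ, hθ⟩ := exists_test_eq_one n
  refine ⟨multiplierConst w θ, (hw.multiplierConst_lt_top θ).ne, fun φ => ?_⟩
  obtain ⟨R, R_pos, hR⟩ := φ.hasCompactSupport.isBounded.exists_pos_norm_le
  have max_pos : 0 < max R 1 := lt_max_of_lt_left R_pos
  refine ⟨dilateTest (max R 1) max_pos.ne' θ, fun x => ?_, hw.multiplierConst_dilateTest_le _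
    ((le_max_right R 1).trans (le_abs_self _)) θ⟩
  by_cases hx : x ∈ tsupport φ
  · have norm_le_one : ‖(max R 1)⁻¹ • x‖ ≤ 1 := by
      rw [norm_smul, norm_inv, Real.norm_of_nonneg max_pos.le, inv_mul_le_one₀ max_pos]
      exact (hR x hx).trans (le_max_left _ _)
    rw [dilateTest_apply, hθ _ norm_le_one, one_mul]
  · rw [image_eq_zero_of_notMem_tsupport hx, mul_zero]

/-! ### Global membership in `𝓑_k` -/

variable {u : Distr n}

theorem smulDistr_restrict_smulDistr_comm (φ χ : Test n) (u : Distr n) :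
    smulDistr φ (restrict (smulDistr χ u)) = smulDistr χ (restrict (smulDistr φ u)) := by
  ext g
  refine congrArg u (?_ : mulTest χ (mulTest φ g).toSchwartz = mulTest φ (mulTest χ g).toSchwartz)
  ext x
  simp only [mulTest_apply, Test.toSchwartz_apply]
  exact mul_left_comm _ _ _

theorem IsControlWeight.katoNorm_smulDistr_le (hw : IsControlWeight w k) (hk : IsWeight k)
    (χ θ : Test n) (hu : u ∈ hormanderLoc k) :
    katoNorm k 2 χ (restrict (smulDistr θ u)) ≤ multiplierConst w θ * katoNorm k 2 χ u := by
  have control_le (y : Rn n) :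
      control k χ (restrict (smulDistr θ u)) y ≤ multiplierConst w θ * control k χ u y := by
    rw [control, smulDistr_restrict_smulDistr_comm]
    exact hw.hormanderNorm_smulDistr_le hk θ (hu _)
  rw [← ENNReal.pow_le_pow_left_iff (n := 2) two_ne_zero, mul_pow, katoNorm, katoNorm,
    ← lintegral_enorm_sq_eq_eLpNorm_sq, ← lintegral_enorm_sq_eq_eLpNorm_sq,
    ← lintegral_const_mul' _ _ (ENNReal.pow_ne_top (hw.multiplierConst_lt_top θ).ne)]
  refine lintegral_mono fun y => ?_
  rw [← mul_pow]
  exact pow_le_pow_left' (control_le y) 2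

theorem IsWeight.enorm_apply_le (hk : IsWeight k) (hT : T ∈ hormanderSpace k) (φ : 𝓢(Rn n, ℂ)) :
    ‖T φ‖ₑ ≤ eLpNorm (fun ξ => hatInv n φ ξ / (k ξ : ℂ)) 2 volume * hormanderNorm k T := by
  obtain ⟨f, hf⟩ := exists_isFourierDensity hT
  have apply_eq : T φ = ∫ ξ, (hatInv n φ ξ / (k ξ : ℂ)) * ((k ξ : ℂ) * f ξ) := by
    simp only [← mul_assoc, div_mul_cancel₀ _ (hk.ofReal_ne_zero _)]
    rw [← (hf.isFunction.2 (hatInv n φ)).2, hatDistr_apply, hat_hatInv]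
  rw [apply_eq, hf.hormanderNorm_eq, ← ENNReal.pow_le_pow_left_iff (n := 2) two_ne_zero, mul_pow,
    ← lintegral_enorm_sq_eq_eLpNorm_sq, ← lintegral_enorm_sq_eq_eLpNorm_sq]
  refine (pow_le_pow_left' (enorm_integral_le_lintegral_enorm _) 2).trans ?_
  simp only [enorm_mul (_ / _)]
  exact sq_lintegral_mul_le (hk.memLp_schwartz_div _ 2).1.enorm hf.memLp.1.enorm

theorem IsWeight.exists_enorm_apply_le (hk : IsWeight k) {χ : Test n} (hχ : χ ≠ 0)
    (hu : u ∈ hormanderLoc k) (hu_kato : katoNorm k 2 χ u < ⊤) : ∃ M : ℝ≥0, ∀ φ : Test n,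
      ‖u φ‖ₑ ≤ M * eLpNorm (fun ξ => hatInv n φ.toSchwartz ξ / (k ξ : ℂ)) 2 volume := by
  obtain ⟨w, hw⟩ := hk.exists_isControlWeight
  obtain ⟨D, -, norm_equiv⟩ := hk.exists_norm_equiv hχ
  obtain ⟨A, hA, cutoff⟩ := hw.exists_cutoff
  let M := D * (A * katoNorm k 2 χ u)
  have hM : M ≠ ⊤ := ENNReal.mul_ne_top ENNReal.coe_ne_top (ENNReal.mul_ne_top hA hu_kato.ne)
  refine ⟨M.toNNReal, fun φ => ?_⟩
  rw [ENNReal.coe_toNNReal hM]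
  obtain ⟨θ, θ_mul, θ_le⟩ := cutoff φ
  have apply_eq : u φ = smulDistr θ u φ.toSchwartz :=
    congrArg u (TestFunction.ext fun x => (θ_mul x).symm)
  have norm_le : hormanderNorm k (smulDistr θ u) ≤ M := by
    calc hormanderNorm k (smulDistr θ u)
        ≤ D * katoNorm k 2 χ (restrict (smulDistr θ u)) := (norm_equiv _ (hu θ)).2
      _ ≤ D * (multiplierConst w θ * katoNorm k 2 χ u) := by
        gcongr
        exact hw.katoNorm_smulDistr_le hk χ θ hu
      _ ≤ D * (A * katoNorm k 2 χ u) := by gcongr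
  rw [apply_eq, mul_comm]
  exact (hk.enorm_apply_le (hu θ) φ.toSchwartz).trans (mul_le_mul_right norm_le _)

theorem exists_inner_eq_of_norm_le {𝕜 V H : Type*} [RCLike 𝕜] [AddCommGroup V] [Module 𝕜 V]
    [NormedAddCommGroup H] [InnerProductSpace 𝕜 H] [CompleteSpace H] (J : V →ₗ[𝕜] H)
    (l : V →ₗ[𝕜] 𝕜) (M : ℝ) (h : ∀ v, ‖l v‖ ≤ M * ‖J v‖) :
    ∃ g : H, ∀ v, l v = inner 𝕜 g (J v) := by
  have l_mem_range : l ∈ LinearMap.range J.dualMap := by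
    rw [LinearMap.range_dualMap_eq_dualAnnihilator_ker, Submodule.mem_dualAnnihilator]
    intro v hv
    have norm_le := h v
    rw [LinearMap.mem_ker.1 hv, norm_zero, mul_zero] at norm_le
    exact norm_le_zero_iff.1 norm_le
  obtain ⟨l', rfl⟩ := l_mem_range
  let L : J.range →L[𝕜] 𝕜 := (l'.domRestrict J.range).mkContinuous M (by
    rintro ⟨-, v, rfl⟩
    exact h v)
  obtain ⟨G, hG, -⟩ := exists_extension_norm_eq J.range L
  refine ⟨(InnerProductSpace.toDual 𝕜 H).symm G, fun v => ?_⟩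
  rw [InnerProductSpace.toDual_symm_apply]
  exact (hG ⟨J v, LinearMap.mem_range_self J v⟩).symm

/-- The linear map `φ ↦ (𝓕⁻¹ φ) / k` into `L²`, in whose norm the functionals in `𝓑_k` are
bounded. -/
def IsWeight.divToLp (hk : IsWeight k) :
    𝓢(Rn n, ℂ) →ₗ[ℂ] Lp ℂ 2 (volume : Measure (Rn n)) where
  toFun φ := (hk.memLp_schwartz_div (hatInv n φ) 2).toLp
  map_add' φ ψ := by
    rw [← MemLp.toLp_add]
    congr 1
    ext ξ
    simp only [map_add, add_apply, Pi.add_apply, add_div]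
  map_smul' c φ := by
    rw [RingHom.id_apply, ← MemLp.toLp_const_smul]
    congr 1
    ext ξ
    simp only [map_smul, smul_apply, Pi.smul_apply, smul_eq_mul, mul_div_assoc]

theorem IsWeight.inner_divToLp (hk : IsWeight k) (g : Lp ℂ 2 (volume : Measure (Rn n)))
    (φ : 𝓢(Rn n, ℂ)) : inner ℂ g (hk.divToLp φ) =
      ∫ ξ, hatInv n φ ξ * (starRingEnd ℂ (g ξ) / (k ξ : ℂ)) := by
  rw [L2.inner_def]
  refine integral_congr_ae ?_
  filter_upwards [(hk.memLp_schwartz_div (hatInv n φ) 2).coeFn_toLp] with ξ hξ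
  change inner ℂ (g ξ) ((hk.memLp_schwartz_div (hatInv n φ) 2).toLp _ ξ) = _
  rw [hξ, RCLike.inner_apply]
  ring

theorem IsWeight.exists_memLp_eq_integral (hk : IsWeight k) {M : ℝ≥0}
    (h : ∀ φ : Test n,
      ‖u φ‖ₑ ≤ M * eLpNorm (fun ξ => hatInv n φ.toSchwartz ξ / (k ξ : ℂ)) 2 volume) :
    ∃ f : Rn n → ℂ, MemLp (fun ξ => (k ξ : ℂ) * f ξ) 2 ∧
      ∀ φ : Test n, u φ = ∫ ξ, hatInv n φ.toSchwartz ξ * f ξ := by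
  let J : Test n →ₗ[ℂ] Lp ℂ 2 (volume : Measure (Rn n)) :=
    hk.divToLp ∘ₗ (testToSchwartz n : Test n →ₗ[ℂ] 𝓢(Rn n, ℂ))
  have norm_le (φ : Test n) : ‖u φ‖ ≤ M * ‖J φ‖ := by
    have hφ := hk.memLp_schwartz_div (hatInv n φ.toSchwartz) 2
    have := ENNReal.toReal_mono (ENNReal.mul_ne_top ENNReal.coe_ne_top hφ.2.ne) (h φ)
    rwa [toReal_enorm, ENNReal.toReal_mul, ENNReal.coe_toReal, ← Lp.norm_toLp _ hφ] at this
  obtain ⟨g, hg⟩ := exists_inner_eq_of_norm_le J (u : Test n →ₗ[ℂ] ℂ) M norm_le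
  refine ⟨fun ξ => starRingEnd ℂ (g ξ) / (k ξ : ℂ), ?_, fun φ =>
    (hg φ).trans (hk.inner_divToLp g φ.toSchwartz)⟩
  simp only [mul_div_cancel₀ _ (hk.ofReal_ne_zero _)]
  exact (Lp.memLp g).star

theorem IsWeight.exists_hatDistr_eq (hk : IsWeight k)
    (hf : MemLp (fun ξ => (k ξ : ℂ) * f ξ) 2) :
    ∃ T : 𝓢'(Rn n, ℂ), ∀ φ, hatDistr T φ = ∫ ξ, φ ξ * f ξ := by
  obtain ⟨w, hw⟩ := hk.exists_isControlWeight
  have hf_div := hw.memLp_inv_smul hk hf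
  have ofReal_hasTemperateGrowth : (fun ξ => (w ξ : ℂ)).HasTemperateGrowth :=
    Complex.ofRealCLM.hasTemperateGrowth.comp hw.hasTemperateGrowth
  obtain ⟨T, hT⟩ := hatDistr_surjective (TemperedDistribution.smulLeftCLM ℂ (fun ξ => (w ξ : ℂ))
    (Lp.toTemperedDistribution hf_div.toLp))
  refine ⟨T, fun φ => ?_⟩
  rw [hT, TemperedDistribution.smulLeftCLM_apply_apply, Lp.toTemperedDistribution_apply]
  refine integral_congr_ae ?_
  filter_upwards [hf_div.coeFn_toLp] with ξ hξ
  rw [hξ, SchwartzMap.smulLeftCLM_apply_apply ofReal_hasTemperateGrowth, Complex.coe_smul,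
    smul_eq_mul, smul_mul_smul_comm, mul_inv_cancel₀ (hw.pos ξ).ne', one_smul]

theorem IsWeight.mem_image_restrict (hk : IsWeight k) {χ : Test n} (hχ : χ ≠ 0)
    (hu : u ∈ hormanderLoc k) (hu_kato : katoNorm k 2 χ u < ⊤) :
    u ∈ restrict '' hormanderSpace k := by
  obtain ⟨M, hM⟩ := hk.exists_enorm_apply_le hχ hu hu_kato
  obtain ⟨f, hf, huf⟩ := hk.exists_memLp_eq_integral hM
  obtain ⟨T, hT⟩ := hk.exists_hatDistr_eq hf
  refine ⟨T, ⟨f, hk.isFunction hf hT, hf⟩, ?_⟩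
  ext φ
  rw [restrict_apply, huf, ← hT, hatDistr_apply, hat_hatInv]

theorem IsWeight.katoSpace_subset (hk : IsWeight k) :
    katoSpace k 2 ⊆ restrict '' hormanderSpace k := by
  rintro u ⟨χ, hχ, hu, hu_memLp⟩
  exact hk.mem_image_restrict hχ (hk.mem_hormanderLoc hχ hu) hu_memLp.2

theorem IsWeight.image_restrict_subset_wienerAmalgam (hk : IsWeight k) {χ : Test n}
    (hχ : χ ≠ 0) : restrict '' hormanderSpace k ⊆ wienerAmalgam k 2 χ := by
  rintro - ⟨T, hT, rfl⟩
  exact ⟨fun φ => hk.smulDistr_mem φ hT, hk.memLp_control hχ hT⟩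

theorem wienerAmalgam_subset_katoSpace {p : ℝ≥0∞} {χ : Test n} (hχ : χ ≠ 0) :
    wienerAmalgam k p χ ⊆ katoSpace k p :=
  fun _ hu => ⟨χ, hχ, fun y => hu.1 (translate y χ), hu.2⟩

end Kato

end

theorem mainTheorem5 (n : ℕ) (k : Kato.Rn n → ℝ) (hk : Kato.IsWeight k) :
    Kato.restrict '' Kato.hormanderSpace k = Kato.katoSpace k 2 ∧
    (∀ χ : Kato.Test n, χ ≠ 0 → Kato.katoSpace k 2 = Kato.wienerAmalgam k 2 χ) ∧
    (∀ χ : Kato.Test n, χ ≠ 0 → ∃ C : ℝ≥0, 0 < C ∧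
      ∀ T ∈ Kato.hormanderSpace k,
        Kato.katoNorm k 2 χ (Kato.restrict T) ≤ C * Kato.hormanderNorm k T ∧
        Kato.hormanderNorm k T ≤ C * Kato.katoNorm k 2 χ (Kato.restrict T)) := by
  refine ⟨?_, fun χ hχ => ?_, fun χ hχ => hk.exists_norm_equiv hχ⟩
  · obtain ⟨θ, hθ⟩ := Kato.exists_test_ne_zero n
    exact (hk.image_restrict_subset_wienerAmalgam hθ).trans
      (Kato.wienerAmalgam_subset_katoSpace hθ) |>.antisymm hk.katoSpace_subset
  · exact (hk.katoSpace_subset.trans (hk.image_restrict_subset_wienerAmalgam hχ)).antisymm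
      (Kato.wienerAmalgam_subset_katoSpace hχ)
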